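/- Let $B$ be a finite-dimensional C*-algebra and let $X$ be a C*-correspondence over $B$, that is, a right Hilbert $B$-module with inner product $\langle\cdot\,|\,\cdot\rangle$, linear in the second variable, and a $*$-homomorphism $\varphi_X:B\to\mathcal L(X)$ into the adjointable operators. Let $\mathcal K(X)$ be the closed linear span of the rank-one operators $\theta_{\xi,\eta}:\mu\mapsto\xi\cdot\langle\eta\,|\,\mu\rangle$, and let $J_X=\varphi_X^{-1}(\mathcal K(X))\cap(\ker\varphi_X)^\perp$ be the Katsura ideal, where $(\ker\varphi_X)^\perp=\{y\in B: xy=0\text{ for all }x\in\ker\varphi_X\}$. A Toeplitz representation of $X$ in a C*-algebra $D$ is a pair $(\pi,t)$ of a $*$-homomorphism $\pi:B\to D$ and a linear map $t:X\to D$ with $\pi(b)t(\xi)=t(\varphi_X(b)\xi)$ and $t(\xi)^*t(\eta)=\pi(\langle\xi\,|\,\eta\rangle)$. It induces the $*$-homomorphism $\psi_t:\mathcal K(X)\to D$ with $\psi_t(\theta_{\xi,\eta})=t(\xi)t(\eta)^*$. For a closed two-sided $*$-ideal $I\subseteq J_X$ of $B$, the relative Cuntz--Pimsner algebra $\mathcal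 O(I,X)$ is the C*-algebra generated by a Toeplitz representation $(\pi_X^I,t_X^I)$ that is universal among the Toeplitz representations with $\pi(b)=\psi_t(\varphi_X(b))$ for all $b\in I$. The Cuntz--Pimsner algebra is $\mathcal O_X=\mathcal O(J_X,X)$, with universal representation $(\pi_X,t_X)$, and $\tau^I:\mathcal O(I,X)\to\mathcal O_X$ is the canonical $*$-homomorphism, determined by $\tau^I\circ\pi_X^I=\pi_X$ and $\tau^I\circ t_X^I=t_X$. Suppose that $\varphi_X$ is injective and that $\varphi_X(B)\subseteq\mathcal K(X)$ (so that $J_X=B$). If $I$ is a proper closed two-sided $*$-ideal of $B$, then $\tau^I$ is surjective and not injective. -/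

import Mathlib

open scoped ENNReal

noncomputable section

universe u v w

namespace CStarCorr

section HilbertModule

/- A right Hilbert `B`-module is a Banach space `X` with a right action of `B` (an action of the
opposite algebra `Bᵐᵒᵖ`, as usual in Mathlib) and a `Bᵐᵒᵖ`-valued inner product which is
`Bᵐᵒᵖ`-linear in the second variable, that is, an instance of `CStarModule Bᵐᵒᵖ X`, complete for
its norm `‖ξ‖ = √‖⟨ξ|ξ⟩‖`. -/
variable {B : Type u} {X : Type v} [NonUnitalCStarAlgebra B] [PartialOrder B]
  [NormedAddCommGroup X] [NormedSpace ℂ X] [SMul Bᵐᵒᵖ X] [CStarModule Bᵐᵒᵖ X]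

/-- The `B`-valued inner product `⟨ξ|η⟩` of a right Hilbert `B`-module, linear in `η`. -/
def rinner (B : Type u) {X : Type v} [NonUnitalCStarAlgebra B] [PartialOrder B]
    [NormedAddCommGroup X] [NormedSpace ℂ X] [SMul Bᵐᵒᵖ X] [CStarModule Bᵐᵒᵖ X] (ξ η : X) : B :=
  MulOpposite.unop (inner Bᵐᵒᵖ ξ η)

/-- The right action `ξ · b`. -/
def ract (ξ : X) (b : B) : X := MulOpposite.op b • ξ

lemma rinner_ract (ξ η : X) (b : B) : rinner B ξ (ract η b) = rinner B ξ η * b := by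
  simp [rinner, ract]

lemma star_rinner (ξ η : X) : star (rinner B ξ η) = rinner B η ξ := by
  rw [rinner, rinner, ← MulOpposite.unop_star, CStarModule.star_inner]

lemma rinner_add_right (ξ η ζ : X) : rinner B ξ (η + ζ) = rinner B ξ η + rinner B ξ ζ := by
  simp [rinner]

lemma rinner_smul_right (ξ η : X) (z : ℂ) : rinner B ξ (z • η) = z • rinner B ξ η := by
  simp [rinner]

lemma rinner_sub_right (ξ η ζ : X) : rinner B ξ (η - ζ) = rinner B ξ η - rinner B ξ ζ := by
  simp [rinner]

lemma rinner_ext {ξ η : X} (h : ∀ ζ : X, rinner B ζ ξ = rinner B ζ η) : ξ = η := by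
  have h1 : rinner B (ξ - η) (ξ - η) = 0 := by rw [rinner_sub_right, h, sub_self]
  have h2 : inner Bᵐᵒᵖ (ξ - η) (ξ - η) = 0 := MulOpposite.unop_injective h1
  exact sub_eq_zero.1 (CStarModule.inner_self.1 h2)

lemma norm_sq_rinner (ξ : X) : ‖ξ‖ ^ 2 = ‖rinner B ξ ξ‖ :=
  CStarModule.norm_sq_eq Bᵐᵒᵖ

lemma ract_add (ξ : X) (a b : B) : ract ξ (a + b) = ract ξ a + ract ξ b :=
  rinner_ext (B := B) fun ζ => by simp only [rinner_ract, rinner_add_right, mul_add]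

lemma ract_smul (ξ : X) (z : ℂ) (b : B) : ract ξ (z • b) = z • ract ξ b :=
  rinner_ext (B := B) fun ζ => by simp only [rinner_ract, rinner_smul_right, mul_smul_comm]

lemma rinner_ract_left (ξ η : X) (b : B) : rinner B (ract ξ b) η = star b * rinner B ξ η := by
  rw [← star_rinner, rinner_ract, star_mul, star_rinner]

lemma norm_ract_le (ξ : X) (b : B) : ‖ract ξ b‖ ≤ ‖ξ‖ * ‖b‖ := by
  refine le_of_sq_le_sq ?_ (by positivity)
  calc ‖ract ξ b‖ ^ 2 = ‖star b * (rinner B ξ ξ * b)‖ := by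
        rw [norm_sq_rinner (B := B), rinner_ract, rinner_ract_left, mul_assoc]
    _ ≤ ‖b‖ * (‖rinner B ξ ξ‖ * ‖b‖) := by
        refine (norm_mul_le _ _).trans ?_
        rw [norm_star]
        gcongr
        exact norm_mul_le _ _
    _ = (‖ξ‖ * ‖b‖) ^ 2 := by rw [← norm_sq_rinner]; ring

lemma norm_rinner_le [StarOrderedRing B] (ξ η : X) : ‖rinner B ξ η‖ ≤ ‖ξ‖ * ‖η‖ :=
  CStarModule.norm_inner_le (A := Bᵐᵒᵖ) X

variable [StarOrderedRing B]

/-- The rank-one operator `θ_{ξ,η} : μ ↦ ξ · ⟨η|μ⟩`. -/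
def rankOne (B : Type u) {X : Type v} [NonUnitalCStarAlgebra B] [PartialOrder B]
    [StarOrderedRing B] [NormedAddCommGroup X] [NormedSpace ℂ X] [SMul Bᵐᵒᵖ X]
    [CStarModule Bᵐᵒᵖ X] (ξ η : X) : X →L[ℂ] X :=
  LinearMap.mkContinuous
    { toFun := fun μ => ract ξ (rinner B η μ)
      map_add' := fun μ ν => by rw [rinner_add_right, ract_add]
      map_smul' := fun z μ => by rw [rinner_smul_right, ract_smul, RingHom.id_apply] }
    (‖ξ‖ * ‖η‖) (fun μ => by
      refine (norm_ract_le ξ (rinner B η μ)).trans ?_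
      rw [mul_assoc]
      gcongr
      exact norm_rinner_le η μ)

lemma rankOne_apply (ξ η μ : X) : rankOne B ξ η μ = ract ξ (rinner B η μ) := rfl

/-- `𝒦(X)`: the norm-closed linear span of the rank-one operators. (An adjointable operator is
bounded, and the norm of `ℒ(X)` is the operator norm, so the closure may be taken among all the
bounded operators.) -/
def compactOps (B : Type u) (X : Type v) [NonUnitalCStarAlgebra B] [PartialOrder B]
    [StarOrderedRing B] [NormedAddCommGroup X] [NormedSpace ℂ X] [SMul Bᵐᵒᵖ X]
    [CStarModule Bᵐᵒᵖ X] : Submodule ℂ (X →L[ℂ] X) :=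
  (Submodule.span ℂ (Set.range fun p : X × X => rankOne B p.1 p.2)).topologicalClosure

lemma rankOne_mem (ξ η : X) : rankOne B ξ η ∈ compactOps B X :=
  Submodule.le_topologicalClosure _ (Submodule.subset_span ⟨(ξ, η), rfl⟩)

instance : IsBoundedSMul ℂ (compactOps B X) :=
  .of_norm_smul_le fun r T => norm_smul_le r (T : X →L[ℂ] X)

/-- The linear map `∑ cᵢ (ξᵢ, ηᵢ) ↦ ∑ cᵢ θ_{ξᵢ,ηᵢ}` into `𝒦(X)`. -/
def finiteRank (B : Type u) (X : Type v) [NonUnitalCStarAlgebra B] [PartialOrder B]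
    [StarOrderedRing B] [NormedAddCommGroup X] [NormedSpace ℂ X] [SMul Bᵐᵒᵖ X]
    [CStarModule Bᵐᵒᵖ X] : (X × X →₀ ℂ) →ₗ[ℂ] compactOps B X :=
  Finsupp.linearCombination ℂ fun p : X × X => (⟨rankOne B p.1 p.2, rankOne_mem p.1 p.2⟩)

lemma coe_finiteRank (f : X × X →₀ ℂ) : (finiteRank B X f : X →L[ℂ] X) =
    Finsupp.linearCombination ℂ (fun p : X × X => rankOne B p.1 p.2) f := by
  simp [finiteRank, Finsupp.linearCombination_apply, Finsupp.sum]

lemma denseRange_finiteRank : DenseRange (finiteRank B X) := by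
  intro T
  have hT : (T : X →L[ℂ] X) ∈ closure
      (Submodule.span ℂ (Set.range fun p : X × X => rankOne B p.1 p.2) : Set (X →L[ℂ] X)) := T.2
  rw [closure_subtype]
  refine closure_mono ?_ hT
  intro S hS
  rw [SetLike.mem_coe, ← Set.image_univ, Finsupp.mem_span_image_iff_linearCombination] at hS
  obtain ⟨f, -, rfl⟩ := hS
  exact ⟨finiteRank B X f, ⟨f, rfl⟩, coe_finiteRank f⟩

end HilbertModule

/-- A C*-correspondence over `B`: a right Hilbert `B`-module `X` with a `*`-homomorphism
`φ_X : B → ℒ(X)`, that is, a homomorphism into the bounded operators for which `φ_X (b*)` is an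
adjoint of `φ_X b`. -/
structure Correspondence (B : Type u) (X : Type v) [NonUnitalCStarAlgebra B] [PartialOrder B]
    [StarOrderedRing B] [NormedAddCommGroup X] [NormedSpace ℂ X] [CompleteSpace X]
    [SMul Bᵐᵒᵖ X] [CStarModule Bᵐᵒᵖ X] where
  leftAct : B →ₙₐ[ℂ] (X →L[ℂ] X)
  rinner_leftAct : ∀ (b : B) (ξ η : X),
    rinner B (leftAct b ξ) η = rinner B ξ (leftAct (star b) η)

section Correspondence

variable {B : Type u} {X : Type v} [NonUnitalCStarAlgebra B] [PartialOrder B]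
  [StarOrderedRing B] [NormedAddCommGroup X] [NormedSpace ℂ X] [CompleteSpace X]
  [SMul Bᵐᵒᵖ X] [CStarModule Bᵐᵒᵖ X]

/-- The Katsura ideal `J_X = φ_X⁻¹(𝒦(X)) ∩ (ker φ_X)^⊥`. -/
def Correspondence.katsuraIdeal (E : Correspondence B X) : Set B :=
  {y | E.leftAct y ∈ compactOps B X ∧ ∀ x : B, E.leftAct x = 0 → x * y = 0}

/-- A Toeplitz representation `(π, t)` of the correspondence in a C*-algebra `D`. -/
structure ToeplitzRep (E : Correspondence B X) (D : Type w) [NonUnitalCStarAlgebra D] where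
  π : B →⋆ₙₐ[ℂ] D
  t : X →ₗ[ℂ] D
  π_mul_t : ∀ (b : B) (ξ : X), π b * t ξ = t (E.leftAct b ξ)
  star_t_mul_t : ∀ ξ η : X, star (t ξ) * t η = π (rinner B ξ η)

namespace ToeplitzRep

variable {E : Correspondence B X} {D : Type w} [NonUnitalCStarAlgebra D]

lemma t_mul_π (R : ToeplitzRep E D) (ξ : X) (b : B) : R.t ξ * R.π b = R.t (ract ξ b) := by
  have h : ∀ η : X, star (R.t η) * (R.t ξ * R.π b - R.t (ract ξ b)) = 0 := by
    intro η
    rw [mul_sub, ← mul_assoc, R.star_t_mul_t, R.star_t_mul_t, rinner_ract, map_mul, sub_self]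
  rw [← sub_eq_zero, ← CStarRing.star_mul_self_eq_zero_iff]
  rw [star_sub, star_mul, sub_mul, mul_assoc, h, h]
  simp

lemma norm_t_le (R : ToeplitzRep E D) (ξ : X) : ‖R.t ξ‖ ≤ ‖ξ‖ := by
  refine le_of_sq_le_sq ?_ (norm_nonneg _)
  rw [norm_sq_rinner (B := B) ξ, sq, ← CStarRing.norm_star_mul_self, R.star_t_mul_t]
  exact NonUnitalStarAlgHom.norm_apply_le R.π _

/-- The linear map `∑ cᵢ (ξᵢ, ηᵢ) ↦ ∑ cᵢ t(ξᵢ) t(ηᵢ)*`. -/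
def finiteRankMap (R : ToeplitzRep E D) : (X × X →₀ ℂ) →ₗ[ℂ] D :=
  Finsupp.linearCombination ℂ fun p : X × X => R.t p.1 * star (R.t p.2)

/-- The canonical map `ψ_t : 𝒦(X) → D`, the continuous linear map with
`ψ_t(θ_{ξ,η}) = t(ξ) t(η)*`: see `ToeplitzRep.compactMap_rankOne`. -/
def compactMap (R : ToeplitzRep E D) : compactOps B X →L[ℂ] D :=
  R.finiteRankMap.extendOfNorm (finiteRank B X)

/-- `(π, t)` is co-isometric on `S` if `π(b) = ψ_t(φ_X(b))` for all `b ∈ S`. -/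
def IsCoisometricOn (R : ToeplitzRep E D) (S : Set B) : Prop :=
  ∀ b ∈ S, ∃ h : E.leftAct b ∈ compactOps B X, R.π b = R.compactMap ⟨E.leftAct b, h⟩

lemma finiteRankMap_mul_t (R : ToeplitzRep E D) (f : X × X →₀ ℂ) (μ : X) :
    R.finiteRankMap f * R.t μ = R.t ((finiteRank B X f : X →L[ℂ] X) μ) := by
  rw [coe_finiteRank, finiteRankMap]
  induction f using Finsupp.induction_linear with
  | zero => simp
  | add f g hf hg => simp only [map_add, add_mul, hf, hg, _root_.add_apply]
  | single p c =>
    simp only [Finsupp.linearCombination_single, smul_mul_assoc, _root_.smul_apply,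
      map_smul, rankOne_apply, mul_assoc, R.star_t_mul_t, R.t_mul_π]

lemma exists_adjoint (R : ToeplitzRep E D) (f : X × X →₀ ℂ) : ∃ g : X × X →₀ ℂ,
    R.finiteRankMap g = star (R.finiteRankMap f) ∧
    ∀ ξ η : X, rinner B ((finiteRank B X g : X →L[ℂ] X) ξ) η =
      rinner B ξ ((finiteRank B X f : X →L[ℂ] X) η) := by
  simp only [coe_finiteRank, finiteRankMap]
  induction f using Finsupp.induction_linear with
  | zero =>
    refine ⟨0, by simp, fun ξ η => ?_⟩
    simp [rinner]
  | add f g hf hg =>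
    obtain ⟨f', hf1, hf2⟩ := hf
    obtain ⟨g', hg1, hg2⟩ := hg
    refine ⟨f' + g', by simp only [map_add, hf1, hg1, star_add], fun ξ η => ?_⟩
    simp only [map_add, _root_.add_apply, rinner_add_right, ← hf2, ← hg2]
    simp [rinner]
  | single p c =>
    refine ⟨Finsupp.single (p.2, p.1) (star c), by simp, fun ξ η => ?_⟩
    simp only [Finsupp.linearCombination_single, _root_.smul_apply, rankOne_apply,
      rinner_smul_right, rinner_ract]
    rw [← star_rinner, rinner_smul_right, rinner_ract]
    simp [star_rinner]

lemma exists_bound (R : ToeplitzRep E D) (f : X × X →₀ ℂ) : ∃ C : ℝ, 0 ≤ C ∧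
    ∀ (y : Unitization ℂ D) (S : X →L[ℂ] X),
      (∀ μ, y * (R.t μ : Unitization ℂ D) = (R.t (S μ) : Unitization ℂ D)) →
      ‖y * (R.finiteRankMap f : Unitization ℂ D)‖ ≤ C * ‖S‖ := by
  simp only [finiteRankMap]
  induction f using Finsupp.induction_linear with
  | zero => exact ⟨0, le_rfl, fun y S _ => by simp⟩
  | add f g hf hg =>
    obtain ⟨C, hC, hf⟩ := hf
    obtain ⟨C', hC', hg⟩ := hg
    refine ⟨C + C', by positivity, fun y S h => ?_⟩
    rw [map_add, Unitization.inr_add, mul_add, add_mul]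
    exact (norm_add_le _ _).trans (add_le_add (hf y S h) (hg y S h))
  | single p c =>
    refine ⟨‖c‖ * (‖p.1‖ * ‖p.2‖), by positivity, fun y S h => ?_⟩
    rw [Finsupp.linearCombination_single, Unitization.inr_smul, mul_smul_comm, norm_smul,
      Unitization.inr_mul, ← mul_assoc, h, ← Unitization.inr_mul, Unitization.norm_inr, mul_assoc]
    gcongr
    calc ‖R.t (S p.1) * star (R.t p.2)‖ ≤ ‖R.t (S p.1)‖ * ‖star (R.t p.2)‖ := norm_mul_le _ _
      _ ≤ (‖S‖ * ‖p.1‖) * ‖p.2‖ := by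
        rw [norm_star]
        gcongr
        · exact (R.norm_t_le _).trans (S.le_opNorm _)
        · exact R.norm_t_le _
      _ = ‖p.1‖ * ‖p.2‖ * ‖S‖ := by ring

lemma le_of_pow_bound {y s C : ℝ} (hs : 0 ≤ s)
    (h : ∀ n : ℕ, y ^ 2 ^ n ≤ C * s ^ (2 ^ n - 1)) : y ≤ s := by
  rcases hs.eq_or_lt with rfl | hs
  · have := h 1
    norm_num at this
    nlinarith
  · by_contra! hlt
    have h1 : 1 < y / s := (one_lt_div hs).2 hlt
    obtain ⟨n, hn⟩ := pow_unbounded_of_one_lt (C / s) h1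
    have h2 : (y / s) ^ n ≤ (y / s) ^ 2 ^ n :=
      pow_le_pow_right₀ h1.le Nat.lt_two_pow_self.le
    have h3 : (y / s) ^ 2 ^ n ≤ C / s := by
      rw [div_pow, div_le_div_iff₀ (by positivity) hs]
      have h4 : s ^ 2 ^ n = s ^ (2 ^ n - 1) * s := by
        rw [← pow_succ, Nat.sub_add_cancel Nat.one_le_two_pow]
      rw [h4, ← mul_assoc]
      gcongr
      exact h n
    linarith

/-- The map `θ_{ξ,η} ↦ t(ξ) t(η)*` is contractive on finite sums, so that `ψ_t` is well defined. -/
lemma norm_finiteRankMap_le (R : ToeplitzRep E D) (f : X × X →₀ ℂ) :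
    ‖R.finiteRankMap f‖ ≤ 1 * ‖finiteRank B X f‖ := by
  rw [one_mul, Submodule.coe_norm]
  obtain ⟨g, hg1, hg2⟩ := R.exists_adjoint f
  set a := R.finiteRankMap f with ha
  set T : X →L[ℂ] X := (finiteRank B X f : X →L[ℂ] X) with hT
  set T' : X →L[ℂ] X := (finiteRank B X g : X →L[ℂ] X) with hT'
  have hTT : ‖T'‖ ≤ ‖T‖ := by
    refine ContinuousLinearMap.opNorm_le_bound _ (norm_nonneg _) fun ξ => ?_
    have h1 : ‖T' ξ‖ ^ 2 ≤ ‖T' ξ‖ * (‖T‖ * ‖ξ‖) := by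
      rw [norm_sq_rinner (B := B), hg2, mul_comm, mul_comm ‖T‖, mul_assoc]
      refine (norm_rinner_le _ _).trans ?_
      gcongr
      exact T.le_opNorm _
    rcases (norm_nonneg (T' ξ)).eq_or_lt with h0 | h0
    · rw [← h0]; positivity
    · rw [sq] at h1
      exact le_of_mul_le_mul_left h1 h0
  set x : Unitization ℂ D := ((a * star a : D) : Unitization ℂ D) with hx
  have hxt : ∀ (m : ℕ) (μ : X), x ^ m * (R.t μ : Unitization ℂ D) =
      (R.t (((T * T') ^ m) μ) : Unitization ℂ D) := by
    intro m
    induction m with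
    | zero => intro μ; simp
    | succ m ih =>
      intro μ
      have : x * (R.t μ : Unitization ℂ D) = (R.t ((T * T') μ) : Unitization ℂ D) := by
        rw [hx, ← Unitization.inr_mul, mul_assoc, ← hg1, finiteRankMap_mul_t, ha,
          finiteRankMap_mul_t]
        rfl
      rw [pow_succ, mul_assoc, this, ih, pow_succ]
      rfl
  obtain ⟨C, hC, hb⟩ := R.exists_bound f
  have hsa : IsSelfAdjoint x := by
    rw [hx, isSelfAdjoint_iff, ← Unitization.inr_star, star_mul, star_star]
  have hnx : ‖x‖ = ‖a‖ ^ 2 := by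
    rw [hx, Unitization.norm_inr, CStarRing.norm_self_mul_star, sq]
  have key : ‖x‖ ≤ ‖T * T'‖ := by
    refine le_of_pow_bound (C := C * ‖a‖) (norm_nonneg _) fun n => ?_
    have h1 : ‖x ^ 2 ^ n‖ = ‖x‖ ^ 2 ^ n := by
      have := hsa.nnnorm_pow_two_pow n
      simpa only [NNReal.coe_pow, coe_nnnorm] using congrArg NNReal.toReal this
    have hp : 2 ^ n = (2 ^ n - 1) + 1 := (Nat.sub_add_cancel Nat.one_le_two_pow).symm
    rw [← h1]
    calc ‖x ^ 2 ^ n‖ = ‖x ^ (2 ^ n - 1) * (a : Unitization ℂ D) * ((star a : D) : Unitization ℂ D)‖ := by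
          conv_lhs => rw [hp, pow_succ]
          rw [mul_assoc, ← Unitization.inr_mul]
      _ ≤ (C * ‖(T * T') ^ (2 ^ n - 1)‖) * ‖a‖ := by
          refine (norm_mul_le _ _).trans ?_
          rw [Unitization.norm_inr, norm_star]
          gcongr
          exact hb _ _ (hxt _)
      _ ≤ C * ‖a‖ * ‖T * T'‖ ^ (2 ^ n - 1) := by
          rw [mul_right_comm]
          gcongr
          rcases Nat.eq_zero_or_pos (2 ^ n - 1) with h0 | h0
          · rw [h0, pow_zero, pow_zero]
            exact ContinuousLinearMap.norm_id_le
          · exact norm_pow_le' _ h0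
  have : ‖a‖ ^ 2 ≤ ‖T‖ ^ 2 := by
    rw [← hnx]
    refine key.trans ((norm_mul_le _ _).trans ?_)
    rw [sq]
    gcongr
  exact le_of_sq_le_sq this (norm_nonneg _)

lemma compactMap_finiteRank (R : ToeplitzRep E D) (f : X × X →₀ ℂ) :
    R.compactMap (finiteRank B X f) = R.finiteRankMap f := by
  unfold compactMap
  have h1 : ∃ C : ℝ, ∀ f, ‖R.finiteRankMap f‖ ≤ C * ‖finiteRank B X f‖ :=
    ⟨1, R.norm_finiteRankMap_le⟩
  have h2 := denseRange_finiteRank (B := B) (X := X)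
  generalize R.finiteRankMap = g at *
  generalize finiteRank B X = e at *
  exact LinearMap.extendOfNorm_eq h2 h1 f

lemma compactMap_rankOne (R : ToeplitzRep E D) (ξ η : X) :
    R.compactMap ⟨rankOne B ξ η, rankOne_mem ξ η⟩ = R.t ξ * star (R.t η) := by
  have h := R.compactMap_finiteRank (Finsupp.single (ξ, η) 1)
  have h1 : finiteRank B X (Finsupp.single (ξ, η) 1) = ⟨rankOne B ξ η, rankOne_mem ξ η⟩ := by
    rw [finiteRank, Finsupp.linearCombination_single, one_smul]
  rwa [h1, finiteRankMap, Finsupp.linearCombination_single, one_smul] at h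

lemma norm_compactMap_le (R : ToeplitzRep E D) (T : compactOps B X) :
    ‖R.compactMap T‖ ≤ ‖T‖ := by
  unfold compactMap
  have h1 := R.norm_finiteRankMap_le
  have h2 := denseRange_finiteRank (B := B) (X := X)
  generalize R.finiteRankMap = g at *
  generalize finiteRank B X = e at *
  have h3 := LinearMap.norm_extendOfNorm_apply_le h2 1 h1 T
  rwa [one_mul] at h3

lemma compactMap_unique (R : ToeplitzRep E D) (ψ : compactOps B X →L[ℂ] D)
    (h : ∀ ξ η : X, ψ ⟨rankOne B ξ η, rankOne_mem ξ η⟩ = R.t ξ * star (R.t η)) :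
    R.compactMap = ψ := by
  have h3 : ∀ f, ψ (finiteRank B X f) = R.finiteRankMap f := by
    intro f
    rw [finiteRank, finiteRankMap, Finsupp.linearCombination_apply,
      Finsupp.linearCombination_apply, Finsupp.sum, Finsupp.sum, map_sum]
    exact Finset.sum_congr rfl fun p _ => by rw [map_smul, h]
  have h2 := denseRange_finiteRank (B := B) (X := X)
  refine ContinuousLinearMap.ext fun T => ?_
  refine congrFun (h2.equalizer R.compactMap.continuous ψ.continuous ?_) T
  funext f
  exact (R.compactMap_finiteRank f).trans (h3 f).symm

/-- The composition of a Toeplitz representation with a `*`-homomorphism. -/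
def map (R : ToeplitzRep E D) {D' : Type*} [NonUnitalCStarAlgebra D'] (ρ : D →⋆ₙₐ[ℂ] D') :
    ToeplitzRep E D' where
  π := ρ.comp R.π
  t := (ρ : D →ₗ[ℂ] D').comp R.t
  π_mul_t b ξ := by
    simpa using congrArg ρ (R.π_mul_t b ξ)
  star_t_mul_t ξ η := by
    have h := congrArg ρ (R.star_t_mul_t ξ η)
    rw [map_mul, map_star] at h
    exact h

lemma compactMap_map (R : ToeplitzRep E D) {D' : Type*} [NonUnitalCStarAlgebra D']
    (ρ : D →⋆ₙₐ[ℂ] D') (T : compactOps B X) :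
    (R.map ρ).compactMap T = ρ (R.compactMap T) := by
  let ρ' : D →L[ℂ] D' := LinearMap.mkContinuous (ρ : D →ₗ[ℂ] D') 1 fun x => by
    simpa using NonUnitalStarAlgHom.norm_apply_le ρ x
  rw [(R.map ρ).compactMap_unique (ρ'.comp R.compactMap) fun ξ η => ?_]
  · rfl
  · rw [ContinuousLinearMap.comp_apply, compactMap_rankOne]
    change ρ _ = ρ _ * star (ρ _)
    rw [map_mul, map_star]

lemma IsCoisometricOn.map {R : ToeplitzRep E D} {S : Set B} (hR : R.IsCoisometricOn S)
    {D' : Type*} [NonUnitalCStarAlgebra D'] (ρ : D →⋆ₙₐ[ℂ] D') :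
    (R.map ρ).IsCoisometricOn S := by
  intro b hb
  obtain ⟨h, hb⟩ := hR b hb
  exact ⟨h, by rw [compactMap_map, ← hb]; rfl⟩

/-- The product of a family of Toeplitz representations, in the C*-algebra of bounded families. -/
def pi {ι : Type*} {A : ι → Type w} [∀ i, NonUnitalCStarAlgebra (A i)]
    (R : ∀ i, ToeplitzRep E (A i)) : ToeplitzRep E (lp A ∞) where
  π :=
    { toFun := fun b => ⟨fun i => (R i).π b, memℓp_infty ⟨‖b‖, by
        rintro _ ⟨i, rfl⟩
        exact NonUnitalStarAlgHom.norm_apply_le (R i).π b⟩⟩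
      map_smul' := fun z b => by ext i; exact map_smul (R i).π z b
      map_zero' := by ext i; exact map_zero (R i).π
      map_add' := fun a b => by ext i; exact map_add (R i).π a b
      map_mul' := fun a b => by ext i; exact map_mul (R i).π a b
      map_star' := fun b => by ext i; exact map_star (R i).π b }
  t :=
    { toFun := fun ξ => ⟨fun i => (R i).t ξ, memℓp_infty ⟨‖ξ‖, by
        rintro _ ⟨i, rfl⟩
        exact (R i).norm_t_le ξ⟩⟩
      map_smul' := fun z b => by ext i; exact map_smul (R i).t z b
      map_add' := fun a b => by ext i; exact map_add (R i).t a b }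
  π_mul_t b ξ := by ext i; exact (R i).π_mul_t b ξ
  star_t_mul_t ξ η := by ext i; exact (R i).star_t_mul_t ξ η

/-- The coordinate `*`-homomorphisms on the C*-algebra of bounded families. -/
def evalHom {ι : Type*} (A : ι → Type w) [∀ i, NonUnitalCStarAlgebra (A i)] (i : ι) :
    lp A ∞ →⋆ₙₐ[ℂ] A i where
  toFun a := a i
  map_smul' _ _ := rfl
  map_zero' := rfl
  map_add' _ _ := rfl
  map_mul' _ _ := rfl
  map_star' _ := rfl

lemma isCoisometricOn_pi {ι : Type*} {A : ι → Type w} [∀ i, NonUnitalCStarAlgebra (A i)]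
    (R : ∀ i, ToeplitzRep E (A i)) {S : Set B} (hS : ∀ b ∈ S, E.leftAct b ∈ compactOps B X)
    (hR : ∀ i, (R i).IsCoisometricOn S) : (pi R).IsCoisometricOn S := by
  intro b hb
  refine ⟨hS b hb, ?_⟩
  ext i
  obtain ⟨h, hb⟩ := hR i b hb
  exact hb.trans (compactMap_map (pi R) (evalHom A i) _)

/-- The C*-subalgebra `C*(π, t)` generated by a Toeplitz representation. -/
def generated (R : ToeplitzRep E D) : NonUnitalStarSubalgebra ℂ D :=
  (NonUnitalStarAlgebra.adjoin ℂ (Set.range R.π ∪ Set.range R.t)).topologicalClosure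

lemma π_mem (R : ToeplitzRep E D) (b : B) : R.π b ∈ R.generated :=
  NonUnitalStarSubalgebra.le_topologicalClosure _
    (NonUnitalStarAlgebra.subset_adjoin ℂ _ (Or.inl ⟨b, rfl⟩))

lemma t_mem (R : ToeplitzRep E D) (ξ : X) : R.t ξ ∈ R.generated :=
  NonUnitalStarSubalgebra.le_topologicalClosure _
    (NonUnitalStarAlgebra.subset_adjoin ℂ _ (Or.inr ⟨ξ, rfl⟩))

lemma isClosed_generated (R : ToeplitzRep E D) : IsClosed (R.generated : Set D) :=
  NonUnitalStarSubalgebra.isClosed_topologicalClosure _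

instance (R : ToeplitzRep E D) : NonUnitalCStarAlgebra R.generated :=
  NonUnitalStarSubalgebra.nonUnitalCStarAlgebra _ (h_closed := R.isClosed_generated)

/-- A Toeplitz representation, seen in the C*-algebra that it generates. -/
def toGenerated (R : ToeplitzRep E D) : ToeplitzRep E R.generated where
  π := NonUnitalStarAlgHom.codRestrict R.π R.generated R.π_mem
  t := LinearMap.codRestrict R.generated.toNonUnitalSubalgebra.toSubmodule R.t R.t_mem
  π_mul_t b ξ := Subtype.ext (R.π_mul_t b ξ)
  star_t_mul_t ξ η := Subtype.ext (R.star_t_mul_t ξ η)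

lemma IsCoisometricOn.toGenerated {R : ToeplitzRep E D} {S : Set B} (hR : R.IsCoisometricOn S) :
    R.toGenerated.IsCoisometricOn S := by
  intro b hb
  obtain ⟨h, hb⟩ := hR b hb
  refine ⟨h, Subtype.ext ?_⟩
  refine hb.trans ?_
  exact R.toGenerated.compactMap_map (NonUnitalStarSubalgebraClass.subtype R.generated)
    ⟨E.leftAct b, h⟩

lemma generated_le {R : ToeplitzRep E D} {M : NonUnitalStarSubalgebra ℂ D}
    (hM : IsClosed (M : Set D)) (hπ : ∀ b, R.π b ∈ M) (ht : ∀ ξ, R.t ξ ∈ M) :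
    R.generated ≤ M := by
  refine NonUnitalStarSubalgebra.topologicalClosure_minimal _ ?_ hM
  refine NonUnitalStarAlgebra.adjoin_le ?_
  rintro x (⟨b, rfl⟩ | ⟨ξ, rfl⟩)
  · exact hπ b
  · exact ht ξ

lemma generated_toGenerated (R : ToeplitzRep E D) : R.toGenerated.generated = ⊤ := by
  have hc : IsClosed ((R.toGenerated.generated.map
      (NonUnitalStarSubalgebraClass.subtype R.generated) : NonUnitalStarSubalgebra ℂ D) : Set D) :=
    R.isClosed_generated.isClosedEmbedding_subtypeVal.isClosedMap _
      R.toGenerated.isClosed_generated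
  refine eq_top_iff.2 fun x _ => ?_
  obtain ⟨y, hy, hyx⟩ := generated_le hc (fun b => ⟨R.toGenerated.π b, π_mem _ b, rfl⟩)
    (fun ξ => ⟨R.toGenerated.t ξ, t_mem _ ξ, rfl⟩) x.2
  have : y = x := Subtype.ext hyx
  exact this ▸ hy

lemma hom_ext {R : ToeplitzRep E D} (hR : R.generated = ⊤) {D' : Type*}
    [NonUnitalCStarAlgebra D'] {ρ σ : D →⋆ₙₐ[ℂ] D'} (hπ : ∀ b, ρ (R.π b) = σ (R.π b))
    (ht : ∀ ξ, ρ (R.t ξ) = σ (R.t ξ)) : ρ = σ := by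
  have hc : ∀ τ : D →⋆ₙₐ[ℂ] D', Continuous τ := fun τ =>
    AddMonoidHomClass.continuous_of_bound τ 1 fun x => by
      simpa using NonUnitalStarAlgHom.norm_apply_le τ x
  have h := generated_le (R := R) (M := NonUnitalStarAlgHom.equalizer ρ σ)
    (isClosed_eq (hc ρ) (hc σ)) hπ ht
  refine NonUnitalStarAlgHom.ext fun x => ?_
  exact h (hR ▸ NonUnitalStarAlgebra.mem_top : x ∈ R.generated)

end ToeplitzRep

/-- The transport of a C*-algebra structure along a bijection. -/
abbrev transferCStarAlgebra {A : Type w} {A' : Type*} [NonUnitalCStarAlgebra A] (e : A' ≃ A) :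
    NonUnitalCStarAlgebra A' :=
  letI : NonUnitalRing A' := e.nonUnitalRing
  letI : Module ℂ A' := e.module ℂ
  letI f : A' →ₙ+* A := (e.ringEquiv : A' ≃+* A)
  letI : NonUnitalNormedRing A' := NonUnitalNormedRing.induced A' A f e.injective
  have hn : ∀ a : A', ‖a‖ = ‖e a‖ := fun _ => rfl
  have hm : ∀ a b : A', e (a * b) = e a * e b := fun a b => map_mul f a b
  have ha : ∀ a b : A', e (a + b) = e a + e b := fun a b => map_add f a b
  have hs : ∀ (z : ℂ) (a : A'), e (z • a) = z • e a := fun z a => e.apply_symm_apply _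
  { star := fun a => e.symm (star (e a))
    star_involutive := fun a => by simp
    star_mul := fun a b => e.injective (by simp [hm])
    star_add := fun a b => e.injective (by simp [ha])
    norm_mul_self_le := fun a => by
      change ‖e a‖ * ‖e a‖ ≤ ‖e (e.symm (star (e a)) * a)‖
      rw [hm, e.apply_symm_apply, CStarRing.norm_star_mul_self]
    complete := fun {F} hf => by
      have hi : Isometry (e : A' → A) := Isometry.of_dist_eq fun a b => rfl
      exact ((hi.isUniformInducing.completeSpace_congr e.surjective).2 inferInstance).complete hf
    norm_smul_le := fun z a => by
      rw [hn, hs, hn]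
      exact norm_smul_le z (e a)
    smul_assoc := fun z a b => e.injective (by simp only [smul_eq_mul, hm, hs, smul_mul_assoc])
    smul_comm := fun z a b => e.injective (by simp only [smul_eq_mul, hm, hs, mul_smul_comm])
    star_smul := fun z a => e.injective (by
      change e (e.symm (star (e (z • a)))) = e (star z • e.symm (star (e a)))
      simp [hs]) }

lemma exists_transfer {A : Type w} {A' : Type*} [NonUnitalCStarAlgebra A] (e : A' ≃ A) :
    ∃ (_ : NonUnitalCStarAlgebra A') (ρ : A →⋆ₙₐ[ℂ] A'), Function.Injective ρ := by
  let _ := transferCStarAlgebra e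
  exact ⟨inferInstance,
    { toFun := e.symm
      map_smul' := fun z a => by
        change e.symm (z • a) = e.symm (z • e (e.symm a))
        rw [e.apply_symm_apply]
      map_zero' := rfl
      map_add' := fun a b => by
        change e.symm (a + b) = e.symm (e (e.symm a) + e (e.symm b))
        simp
      map_mul' := fun a b => by
        change e.symm (a * b) = e.symm (e (e.symm a) * e (e.symm b))
        simp
      map_star' := fun a => by
        change e.symm (star a) = e.symm (star (e (e.symm a)))
        simp }, e.symm.injective⟩

/-- Formal noncommutative polynomials without constant term in the letters `π(b)`, `t(ξ)` and
`t(ξ)*`. -/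
abbrev Words (B : Type u) (X : Type v) : Type (max u v) :=
  FreeNonUnitalNonAssocAlgebra ℂ (B ⊕ X ⊕ X)

namespace ToeplitzRep

variable {E : Correspondence B X} {D : Type w} [NonUnitalCStarAlgebra D]

/-- The value of a formal polynomial in a Toeplitz representation. -/
def eval (R : ToeplitzRep E D) : Words B X →ₙₐ[ℂ] D :=
  FreeNonUnitalNonAssocAlgebra.lift ℂ (Sum.elim R.π (Sum.elim R.t fun ξ => star (R.t ξ)))

lemma eval_map (R : ToeplitzRep E D) {D' : Type*} [NonUnitalCStarAlgebra D']
    (ρ : D →⋆ₙₐ[ℂ] D') (x : Words B X) : (R.map ρ).eval x = ρ (R.eval x) := by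
  have h : (R.map ρ).eval = (ρ : D →ₙₐ[ℂ] D').comp R.eval := by
    refine FreeNonUnitalNonAssocAlgebra.hom_ext ℂ ?_
    rintro (b | ξ | ξ)
    · simp [eval, ToeplitzRep.map]
      rfl
    · simp [eval, ToeplitzRep.map]
      rfl
    · simp only [eval, ToeplitzRep.map, NonUnitalAlgHom.comp_apply,
        FreeNonUnitalNonAssocAlgebra.lift_of_apply, Sum.elim_inr]
      exact (map_star ρ (R.t ξ)).symm
  rw [h]
  rfl

lemma exists_eval_eq (R : ToeplitzRep E D) {a : D}
    (ha : a ∈ NonUnitalStarAlgebra.adjoin ℂ (Set.range R.π ∪ Set.range R.t)) :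
    ∃ x y : Words B X, R.eval x = a ∧ R.eval y = star a := by
  induction ha using NonUnitalStarAlgebra.adjoin_induction with
  | mem a ha =>
    rcases ha with ⟨b, rfl⟩ | ⟨ξ, rfl⟩
    · exact ⟨.of ℂ (.inl b), .of ℂ (.inl (star b)), by simp [eval], by simp [eval, map_star]⟩
    · exact ⟨.of ℂ (.inr (.inl ξ)), .of ℂ (.inr (.inr ξ)), by simp [eval], by simp [eval]⟩
  | add a b _ _ ha hb =>
    obtain ⟨x, y, hx, hy⟩ := ha
    obtain ⟨x', y', hx', hy'⟩ := hb
    exact ⟨x + x', y + y', by rw [map_add, hx, hx'], by rw [map_add, hy, hy', star_add]⟩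
  | zero => exact ⟨0, 0, map_zero _, by rw [map_zero, star_zero]⟩
  | mul a b _ _ ha hb =>
    obtain ⟨x, y, hx, hy⟩ := ha
    obtain ⟨x', y', hx', hy'⟩ := hb
    exact ⟨x * x', y' * y, by rw [map_mul, hx, hx'], by rw [map_mul, hy, hy', star_mul]⟩
  | smul z a _ ha =>
    obtain ⟨x, y, hx, hy⟩ := ha
    exact ⟨z • x, star z • y, by rw [map_smul, hx], by rw [map_smul, hy, star_smul]⟩
  | star a _ ha =>
    obtain ⟨x, y, hx, hy⟩ := ha
    exact ⟨y, x, hy, by rw [hx, star_star]⟩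

/-- The direct sum of two Toeplitz representations. -/
def prod (R : ToeplitzRep E D) {D' : Type*} [NonUnitalCStarAlgebra D'] (R' : ToeplitzRep E D') :
    ToeplitzRep E (D × D') where
  π := R.π.prod R'.π
  t := R.t.prod R'.t
  π_mul_t b ξ := Prod.ext (R.π_mul_t b ξ) (R'.π_mul_t b ξ)
  star_t_mul_t ξ η := Prod.ext (R.star_t_mul_t ξ η) (R'.star_t_mul_t ξ η)

lemma exists_hom_of_norm_le (R : ToeplitzRep E D) {D' : Type*} [NonUnitalCStarAlgebra D']
    (R' : ToeplitzRep E D') (hle : ∀ x, ‖R'.eval x‖ ≤ ‖R.eval x‖) :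
    ∃ ρ : R.generated →⋆ₙₐ[ℂ] D', (∀ b, ρ (R.toGenerated.π b) = R'.π b) ∧
      ∀ ξ, ρ (R.toGenerated.t ξ) = R'.t ξ := by
  set G := R.prod R' with hG
  have hnorm : ∀ γ ∈ G.generated, ‖γ.2‖ ≤ ‖γ.1‖ := by
    intro γ hγ
    have hcl : IsClosed {γ : D × D' | ‖γ.2‖ ≤ ‖γ.1‖} :=
      isClosed_le continuous_snd.norm continuous_fst.norm
    refine closure_minimal ?_ hcl hγ
    intro a ha
    obtain ⟨x, -, hx, -⟩ := G.exists_eval_eq ha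
    have h1 : R.eval x = a.1 := by
      rw [← hx]; exact G.eval_map (NonUnitalStarAlgHom.fst ℂ D D') x
    have h2 : R'.eval x = a.2 := by
      rw [← hx]; exact G.eval_map (NonUnitalStarAlgHom.snd ℂ D D') x
    rw [Set.mem_ofPred_eq, ← h1, ← h2]
    exact hle x
  have huniq : ∀ γ ∈ G.generated, ∀ γ' ∈ G.generated, γ.1 = γ'.1 → γ.2 = γ'.2 := by
    intro γ hγ γ' hγ' h
    have := hnorm _ (sub_mem hγ hγ')
    rw [Prod.fst_sub, h, sub_self, norm_zero] at this
    exact sub_eq_zero.1 (norm_le_zero_iff.1 this)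
  have hex : ∀ d : R.generated, ∃ γ ∈ G.generated, γ.1 = (d : D) := by
    intro d
    have hiso : Isometry fun γ : G.generated => (γ : D × D').1 := by
      refine Isometry.of_dist_eq fun γ γ' => ?_
      rw [Subtype.dist_eq, dist_eq_norm, dist_eq_norm, Prod.norm_def,
        max_eq_left (hnorm _ (sub_mem γ.2 γ'.2))]
      rfl
    have hr : Set.range (fun γ : G.generated => (γ : D × D').1) =
        (G.generated.map (NonUnitalStarAlgHom.fst ℂ D D') : NonUnitalStarSubalgebra ℂ D) := by
      ext x
      exact ⟨fun ⟨γ, h⟩ => ⟨γ, γ.2, h⟩, fun ⟨γ, h, h'⟩ => ⟨⟨γ, h⟩, h'⟩⟩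
    have hc := hiso.isClosedEmbedding.isClosed_range
    rw [hr] at hc
    obtain ⟨γ, h, h'⟩ := generated_le (R := R) hc (fun b => ⟨G.π b, G.π_mem b, rfl⟩)
      (fun ξ => ⟨G.t ξ, G.t_mem ξ, rfl⟩) d.2
    exact ⟨γ, h, h'⟩
  choose g hg hg1 using hex
  refine ⟨{ toFun := fun d => (g d).2
            map_smul' := fun z d => huniq _ (hg _) _ (SMulMemClass.smul_mem z (hg d)) ?_
            map_zero' := huniq _ (hg _) _ (zero_mem _) ?_
            map_add' := fun a b => huniq _ (hg _) _ (add_mem (hg a) (hg b)) ?_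
            map_mul' := fun a b => huniq _ (hg _) _ (mul_mem (hg a) (hg b)) ?_
            map_star' := fun a => huniq _ (hg _) _ (star_mem (hg a)) ?_ },
    fun b => huniq _ (hg _) _ (G.π_mem b) ?_, fun ξ => huniq _ (hg _) _ (G.t_mem ξ) ?_⟩
  · rw [hg1, Prod.smul_fst, hg1]; rfl
  · rw [hg1]; rfl
  · rw [hg1, Prod.fst_add, hg1, hg1]; rfl
  · rw [hg1, Prod.fst_mul, hg1, hg1]; rfl
  · rw [hg1, Prod.fst_star, hg1]; rfl
  · rw [hg1]; rfl
  · rw [hg1]; rfl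

end ToeplitzRep

/-- The seminorms on formal polynomials coming from the Toeplitz representations that are
co-isometric on `S`. They form a set, which indexes a set of representatives of all these
representations. -/
def repNorms (E : Correspondence B X) (S : Set B) : Set (Words B X → ℝ) :=
  {p | ∃ (D : Type (max u v)) (_ : NonUnitalCStarAlgebra D) (R : ToeplitzRep E D),
    R.IsCoisometricOn S ∧ p = fun x => ‖R.eval x‖}

lemma norm_eval_mem_repNorms {E : Correspondence B X} {S : Set B} {D : Type w}
    [NonUnitalCStarAlgebra D] (R : ToeplitzRep E D) (hR : R.IsCoisometricOn S) :
    (fun x => ‖R.eval x‖) ∈ repNorms E S := by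
  have hsmall : Small.{max u v} R.generated := by
    have hsub : (R.generated : Set D) ⊆
        Set.range fun s : ℕ → Words B X => Filter.limUnder Filter.atTop fun n => R.eval (s n) := by
      intro a ha
      obtain ⟨s, hs, hlim⟩ := mem_closure_iff_seq_limit.1
        (show a ∈ closure (NonUnitalStarAlgebra.adjoin ℂ
          (Set.range R.π ∪ Set.range R.t) : Set D) from ha)
      choose x _ hx _ using fun n => R.exists_eval_eq (hs n)
      refine ⟨x, ?_⟩
      simp only [hx]
      exact hlim.limUnder_eq
    exact small_subset hsub
  obtain ⟨inst, ρ, hρ⟩ := exists_transfer (equivShrink.{max u v} R.generated).symm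
  refine ⟨_, inst, R.toGenerated.map ρ, hR.toGenerated.map ρ, ?_⟩
  funext x
  rw [ToeplitzRep.eval_map, NonUnitalStarAlgHom.norm_map ρ hρ]
  have h : R.eval x = (R.toGenerated.eval x : D) :=
    R.toGenerated.eval_map (NonUnitalStarSubalgebraClass.subtype R.generated) x
  rw [h]
  rfl

section Universal

variable (E : Correspondence B X) (S : Set B)

/-- The C*-algebra of a chosen representation with a given seminorm. -/
def RepAlg (p : repNorms E S) : Type (max u v) := p.2.choose

instance (p : repNorms E S) : NonUnitalCStarAlgebra (RepAlg E S p) := p.2.choose_spec.choose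

/-- A chosen representation, co-isometric on `S`, with a given seminorm. -/
def chosenRep (p : repNorms E S) : ToeplitzRep E (RepAlg E S p) :=
  p.2.choose_spec.choose_spec.choose

lemma chosenRep_spec (p : repNorms E S) : (chosenRep E S p).IsCoisometricOn S ∧
    (p : Words B X → ℝ) = fun x => ‖(chosenRep E S p).eval x‖ :=
  p.2.choose_spec.choose_spec.choose_spec

/-- The direct sum of a set of representatives of all the Toeplitz representations that are
co-isometric on `S`. -/
def sumRep : ToeplitzRep E (lp (RepAlg E S) ∞) := ToeplitzRep.pi (chosenRep E S)

/-- The relative Cuntz--Pimsner algebra `𝒪(S, X)`, generated by the universal Toeplitz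
representation of `X` that is co-isometric on `S`. The universal property is
`RelCuntzPimsner.existsUnique_lift`. -/
def RelCuntzPimsner : Type (max u v) := (sumRep E S).generated

instance : NonUnitalCStarAlgebra (RelCuntzPimsner E S) :=
  inferInstanceAs (NonUnitalCStarAlgebra (sumRep E S).generated)

/-- The Cuntz--Pimsner algebra `𝒪_X = 𝒪(J_X, X)`. -/
abbrev CuntzPimsner : Type (max u v) := RelCuntzPimsner E E.katsuraIdeal

namespace RelCuntzPimsner

/-- The universal representation `(π_X^S, t_X^S)` in `𝒪(S, X)`. -/
def univRep : ToeplitzRep E (RelCuntzPimsner E S) := (sumRep E S).toGenerated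

lemma generated_univRep : (univRep E S).generated = ⊤ :=
  (sumRep E S).generated_toGenerated

variable {E S}

lemma isCoisometricOn_univRep (hS : ∀ b ∈ S, E.leftAct b ∈ compactOps B X) :
    (univRep E S).IsCoisometricOn S :=
  (ToeplitzRep.isCoisometricOn_pi (chosenRep E S) hS
    fun p => (chosenRep_spec E S p).1).toGenerated

/-- The universal property of `𝒪(S, X)`, for C*-algebras `D` in every universe. -/
theorem existsUnique_lift {D : Type w} [NonUnitalCStarAlgebra D] (R : ToeplitzRep E D)
    (hR : R.IsCoisometricOn S) : ∃! ρ : RelCuntzPimsner E S →⋆ₙₐ[ℂ] D,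
      (∀ b, ρ ((univRep E S).π b) = R.π b) ∧ ∀ ξ, ρ ((univRep E S).t ξ) = R.t ξ := by
  refine existsUnique_of_exists_of_unique ?_ fun ρ σ hρ hσ =>
    ToeplitzRep.hom_ext (generated_univRep E S) (fun b => (hρ.1 b).trans (hσ.1 b).symm)
      (fun ξ => (hρ.2 ξ).trans (hσ.2 ξ).symm)
  refine (sumRep E S).exists_hom_of_norm_le R fun x => ?_
  let p : repNorms E S := ⟨fun x => ‖R.eval x‖, norm_eval_mem_repNorms R hR⟩
  have h1 : ‖R.eval x‖ = ‖(chosenRep E S p).eval x‖ := congrFun (chosenRep_spec E S p).2 x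
  have h2 : (chosenRep E S p).eval x = ToeplitzRep.evalHom (RepAlg E S) p ((sumRep E S).eval x) :=
    (sumRep E S).eval_map (ToeplitzRep.evalHom (RepAlg E S) p) x
  rw [h1, h2]
  exact NonUnitalStarAlgHom.norm_apply_le (ToeplitzRep.evalHom (RepAlg E S) p) _

/-- The `*`-homomorphism out of `𝒪(S, X)` given by the universal property. -/
def lift {D : Type w} [NonUnitalCStarAlgebra D] (R : ToeplitzRep E D)
    (hR : R.IsCoisometricOn S) : RelCuntzPimsner E S →⋆ₙₐ[ℂ] D :=
  (existsUnique_lift R hR).choose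

lemma lift_π {D : Type w} [NonUnitalCStarAlgebra D] (R : ToeplitzRep E D)
    (hR : R.IsCoisometricOn S) (b : B) : lift R hR ((univRep E S).π b) = R.π b :=
  (existsUnique_lift R hR).choose_spec.1.1 b

lemma lift_t {D : Type w} [NonUnitalCStarAlgebra D] (R : ToeplitzRep E D)
    (hR : R.IsCoisometricOn S) (ξ : X) : lift R hR ((univRep E S).t ξ) = R.t ξ :=
  (existsUnique_lift R hR).choose_spec.1.2 ξ

/-- The canonical map `τ^S : 𝒪(S, X) → 𝒪_X` for `S ⊆ J_X`: the `*`-homomorphism with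
`τ^S ∘ π_X^S = π_X` and `τ^S ∘ t_X^S = t_X`. -/
def toCuntzPimsner (hS : S ⊆ E.katsuraIdeal) : RelCuntzPimsner E S →⋆ₙₐ[ℂ] CuntzPimsner E :=
  lift (univRep E E.katsuraIdeal) fun b hb =>
    isCoisometricOn_univRep (fun _ h => h.1) b (hS hb)

end RelCuntzPimsner
end Universal
end Correspondence
end CStarCorr
end

/-! Surjectivity: the range of a `*`-homomorphism of C*-algebras is closed, and the range of the
canonical map contains the generators of `𝒪_X`.

Non-injectivity: faithfulness and compactness put `1` in the Katsura ideal, so `π(1) = ψ_t(φ(1))`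
holds in `𝒪_X`. Were the canonical map injective, the same relation would hold in `𝒪(I, X)`, hence
in every Toeplitz representation that is co-isometric on `I`. It therefore suffices to find one such
representation where the relation fails.

Take a positive functional `f` on `B` that vanishes on `I` with `f 1 ≠ 0`; the trace of the left
regular action on the finite-dimensional space `B ⧸ I` works. Form the Fock space `⊕ₙ X^{⊗n} ⊗_B
H_f`, with `H_f` the GNS space of `f`, and let `t` act by creation. On tensors of positive length
`π(b)` and `ψ_t(φ(b))` always agree, since `ψ_t(T) t(ξ) = t(Tξ)`. In degree zero `ψ_t` vanishes,
because `t(ξ)*` does, while `π` is the GNS representation of `f`: it kills `I` but fixes the nonzero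
vacuum under `π(1)`. So the representation is co-isometric on `I` but not at `1`.

The Fock space is built without tensor products, from a scalar kernel on pairs (word in `X`,
coefficient in `B`). Its positivity is complete positivity of `a ↦ ⟨ξ|φ(a)η⟩`, expressed through
`IsGramMatrix` and iterated along words (`isGramMatrix_coef`, `isGramMatrix_wordCoef`). Operators
come from maps of the index set, bounded by means of the C*-identity (`norm_action_le`). The
decisive lemma is `exists_isCoisometricOn_ne`. -/

noncomputable section

/-! ### Closed range of `*`-homomorphisms. -/

namespace NonUnitalStarAlgHom

variable {A : Type*} {D : Type*} [NonUnitalCStarAlgebra A] [NonUnitalCStarAlgebra D]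

lemma continuous_of_cstarAlgebra (ρ : A →⋆ₙₐ[ℂ] D) : Continuous ρ :=
  AddMonoidHomClass.continuous_of_bound ρ 1 fun x => by
    simpa using NonUnitalStarAlgHom.norm_apply_le ρ x

/-- A self-adjoint element in the range of a `*`-homomorphism lifts without increase of norm. -/
lemma exists_map_eq_norm_le_of_isSelfAdjoint (ρ : A →⋆ₙₐ[ℂ] D) {a : A} (ha : IsSelfAdjoint a) :
    ∃ b, ρ b = ρ a ∧ ‖b‖ ≤ ‖ρ a‖ := by
  have hρa : IsSelfAdjoint (ρ a) := ha.map ρ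
  set r := ‖ρ a‖ with hr
  have hr0 : 0 ≤ r := norm_nonneg _
  -- The lift is `a` truncated to `[-r, r]` by functional calculus: its norm is at most `r`, and
  -- truncation does nothing on the quasispectrum of `ρ a`. It fixes `0`, as the non-unital calculus
  -- requires.
  have hf : Continuous fun x : ℝ => max (-r) (min r x) := by fun_prop
  have hf0 : max (-r) (min r 0) = 0 := by simp [hr0]
  refine ⟨cfcₙ (fun x : ℝ => max (-r) (min r x)) a, ?_, norm_cfcₙ_le fun x _ => ?_⟩
  · rw [ρ.map_cfcₙ _ a hf.continuousOn hf0 ρ.continuous_of_cstarAlgebra ha hρa]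
    conv_rhs => rw [← cfcₙ_id' ℝ (ρ a)]
    refine cfcₙ_congr fun x hx => ?_
    have h := norm_apply_le_norm_cfcₙ (fun x : ℝ => x) (ρ a) hx
    rw [cfcₙ_id' ℝ (ρ a), Real.norm_eq_abs, abs_le] at h
    rw [min_eq_right h.2, max_eq_right h.1]
  · rw [Real.norm_eq_abs, abs_le]
    exact ⟨le_max_left _ _, max_le (by linarith) (min_le_left _ _)⟩

/-- Lift the real and imaginary parts separately; the triangle inequality costs the factor `2`,
which is harmless for closedness of the range. -/
lemma exists_map_eq_norm_le (ρ : A →⋆ₙₐ[ℂ] D) (a : A) :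
    ∃ b, ρ b = ρ a ∧ ‖b‖ ≤ 2 * ‖ρ a‖ := by
  set x : A := (2⁻¹ : ℂ) • (a + star a) with hx
  set y : A := (2⁻¹ * Complex.I : ℂ) • (star a - a) with hy
  have hxs : IsSelfAdjoint x := by
    rw [isSelfAdjoint_iff, hx]
    simp [add_comm]
  have hys : IsSelfAdjoint y := by
    rw [isSelfAdjoint_iff, hy, star_smul, star_sub, star_star, ← neg_sub (star a), smul_neg,
      ← neg_smul]
    simp
  have hxy : a = x + Complex.I • y := by
    rw [hx, hy, smul_smul]
    have : Complex.I * (2⁻¹ * Complex.I) = -2⁻¹ := by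
      rw [mul_left_comm, Complex.I_mul_I]
      ring
    rw [this]
    module
  have hxn : ‖ρ x‖ ≤ ‖ρ a‖ := by
    rw [hx, map_smul, map_add, map_star, norm_smul]
    refine (mul_le_mul_of_nonneg_left (norm_add_le _ _) (norm_nonneg _)).trans ?_
    rw [norm_star]
    norm_num
    linarith
  have hyn : ‖ρ y‖ ≤ ‖ρ a‖ := by
    rw [hy, map_smul, map_sub, map_star, norm_smul]
    refine (mul_le_mul_of_nonneg_left (norm_sub_le _ _) (norm_nonneg _)).trans ?_
    rw [norm_star]
    norm_num
    linarith
  obtain ⟨b, hb, hb'⟩ := ρ.exists_map_eq_norm_le_of_isSelfAdjoint hxs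
  obtain ⟨c, hc, hc'⟩ := ρ.exists_map_eq_norm_le_of_isSelfAdjoint hys
  refine ⟨b + Complex.I • c, ?_, ?_⟩
  · rw [map_add, map_smul, hb, hc, ← map_smul, ← map_add, ← hxy]
  · refine (norm_add_le _ _).trans ?_
    rw [norm_smul, Complex.norm_I, one_mul]
    linarith

/-- The range of a `*`-homomorphism between C*-algebras is closed. -/
lemma isClosed_range (ρ : A →⋆ₙₐ[ℂ] D) : IsClosed (Set.range ρ) := by
  let f : NormedAddGroupHom A D := (ρ : A →+ D).mkNormedAddGroupHom 1 fun x => by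
    simpa using NonUnitalStarAlgHom.norm_apply_le ρ x
  have h : f.SurjectiveOnWith f.range 2 := by
    rintro _ ⟨a, rfl⟩
    exact ρ.exists_map_eq_norm_le a
  -- Bounded lifting and completeness of `A` let one lift a limit of range elements by summing lifts
  -- of successive corrections.
  have h' := controlled_closure_of_complete two_pos one_pos h
  refine isClosed_of_closure_subset fun x hx => ?_
  have hr : (f.range : Set D) = Set.range ρ := Set.ext fun _ => Iff.rfl
  obtain ⟨g, hg, -⟩ := h' x (show x ∈ closure (f.range : Set D) from hr ▸ hx)
  exact ⟨g, hg⟩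

end NonUnitalStarAlgHom

/-! ### Surjectivity of the canonical map. -/

namespace CStarCorr.RelCuntzPimsner

variable {B : Type u} {X : Type v} [NonUnitalCStarAlgebra B] [PartialOrder B]
  [StarOrderedRing B] [NormedAddCommGroup X] [NormedSpace ℂ X] [CompleteSpace X]
  [SMul Bᵐᵒᵖ X] [CStarModule Bᵐᵒᵖ X] {E : Correspondence B X} {S : Set B}

lemma toCuntzPimsner_surjective (hS : S ⊆ E.katsuraIdeal) :
    Function.Surjective (toCuntzPimsner hS) := by
  intro y
  have h := ToeplitzRep.generated_le (R := univRep E E.katsuraIdeal)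
    (M := NonUnitalStarAlgHom.range (toCuntzPimsner hS))
    (toCuntzPimsner hS).isClosed_range
    (fun b => ⟨(univRep E S).π b, lift_π _ _ b⟩) (fun ξ => ⟨(univRep E S).t ξ, lift_t _ _ ξ⟩)
  rw [generated_univRep] at h
  exact h (NonUnitalStarAlgebra.mem_top (x := y))

end CStarCorr.RelCuntzPimsner

/-! ### A positive functional that vanishes on the ideal. -/

open scoped ComplexOrder in
/-- The trace of left multiplication on `B ⧸ I` is a positive functional on a finite-dimensional
C*-algebra `B` that vanishes on the proper ideal `I`, but not at `1`. -/
lemma TwoSidedIdeal.exists_positive_functional {B : Type*} [CStarAlgebra B] [PartialOrder B]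
    [StarOrderedRing B] [FiniteDimensional ℂ B] (I : TwoSidedIdeal B) (hI : I ≠ ⊤) :
    ∃ f : B →ₚ[ℂ] ℂ, (∀ b ∈ I, f b = 0) ∧ f 1 ≠ 0 := by
  let J : Ideal B := TwoSidedIdeal.asIdeal I
  have hJ : J ≠ ⊤ := by
    intro h
    refine hI (I.one_mem_iff.1 ?_)
    exact TwoSidedIdeal.mem_asIdeal.1 ((Ideal.eq_top_iff_one J).1 h)
  have : Nontrivial (B ⧸ J) := Submodule.Quotient.nontrivial_iff.2 hJ
  have : FiniteDimensional ℂ (B ⧸ J) :=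
    inferInstanceAs (FiniteDimensional ℂ (B ⧸ J.restrictScalars ℂ))
  let ρ : B →ₐ[ℂ] Module.End ℂ (B ⧸ J) := Algebra.lsmul ℂ ℂ (B ⧸ J)
  refine ⟨.mk₀ (LinearMap.trace ℂ (B ⧸ J) ∘ₗ ρ.toLinearMap) fun b hb => ?_, fun b hb => ?_, ?_⟩
  · change 0 ≤ LinearMap.trace ℂ (B ⧸ J) (ρ b)
    -- The trace is the sum of the eigenvalues, and these lie in the spectrum of `b`, hence in `[0,
    -- ∞)`. No C*-structure on the quotient is needed.
    rw [Module.End.trace_eq_sum_roots_charpoly_of_splits (IsAlgClosed.splits _)]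
    refine Multiset.sum_nonneg fun μ hμ => ?_
    have h := (Module.End.mem_spectrum_iff_isRoot_charpoly _ _).2 (Polynomial.isRoot_of_mem_roots hμ)
    exact spectrum_nonneg_of_nonneg hb (AlgHom.spectrum_apply_subset ρ _ h)
  · have h : ρ b = 0 := by
      refine LinearMap.ext fun x => ?_
      obtain ⟨y, rfl⟩ := Submodule.Quotient.mk_surjective _ x
      change Submodule.Quotient.mk (b • y) = 0
      rw [Submodule.Quotient.mk_eq_zero]
      exact TwoSidedIdeal.mem_asIdeal.2 (I.mul_mem_right _ _ hb)
    change LinearMap.trace ℂ (B ⧸ J) (ρ b) = 0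
    rw [h, map_zero]
  · change LinearMap.trace ℂ (B ⧸ J) (ρ 1) ≠ 0
    rw [map_one, LinearMap.trace_one]
    exact_mod_cast (Module.finrank_pos (R := ℂ) (M := B ⧸ J)).ne'

/-! ### Positive matrices over a C*-algebra. -/

/-- An element `N` that detects the negative part of `M`. -/
lemma IsSelfAdjoint.exists_star_mul_self_eq_neg {A : Type*} [NonUnitalCStarAlgebra A]
    [PartialOrder A] [StarOrderedRing A] {M : A} (hM : IsSelfAdjoint M) : ∃ N T : A,
      star T * T = -(star N * M * N) ∧ (T = 0 → ∃ s, M = star s * s) := by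
  have hN : IsSelfAdjoint M⁻ := (CFC.negPart_nonneg M).isSelfAdjoint
  obtain ⟨R, hR⟩ := CStarAlgebra.nonneg_iff_eq_star_mul_self.1 (CFC.negPart_nonneg M)
  -- With `M⁻ = R* R` one gets `T* T = (M⁻)³ = -M⁻ M M⁻`, since `M⁺ M⁻ = 0`. If `T = 0`, then `(M⁻)²
  -- = R* T = 0`, so `M` is positive.
  refine ⟨M⁻, R * M⁻, ?_, fun hT0 => ?_⟩
  · rw [star_mul, hN.star_eq, mul_assoc, ← mul_assoc (star R), ← hR]
    have h : M⁻ * (M⁻ * M⁻) = -(M⁻ * (M⁺ - M⁻) * M⁻) := by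
      simp [mul_sub, mul_assoc]
    rwa [CFC.posPart_sub_negPart M hM] at h
  · have hN0 : M⁻ = 0 := by
      have h1 : star M⁻ * M⁻ = 0 := by
        rw [hN.star_eq]
        nth_rw 1 [hR]
        rw [mul_assoc, hT0, mul_zero]
      exact (CStarRing.star_mul_self_eq_zero_iff _).1 h1
    have hpos : 0 ≤ M := by
      rw [← CFC.posPart_sub_negPart M hM, hN0, sub_zero]
      exact CFC.posPart_nonneg M
    exact CStarAlgebra.nonneg_iff_eq_star_mul_self.1 hpos

/-- A matrix over a C*-algebra of the form `s* s`, with finitely many rows in `s`. -/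
def IsGramMatrix {ι : Type*} {B : Type*} [NonUnitalSemiring B] [Star B] (P : ι → ι → B) : Prop :=
  ∃ (n : ℕ) (s : Fin n → ι → B), ∀ i j, P i j = ∑ k, star (s k i) * s k j

namespace IsGramMatrix

variable {ι : Type*} {B : Type*}

lemma of_fintype [NonUnitalSemiring B] [Star B] {κ : Type*} [Fintype κ] {P : ι → ι → B}
    (s : κ → ι → B) (h : ∀ i j, P i j = ∑ k, star (s k i) * s k j) : IsGramMatrix P :=
  ⟨Fintype.card κ, fun k => s ((Fintype.equivFin κ).symm k), fun i j => by
    rw [h]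
    exact ((Fintype.equivFin κ).symm.sum_comp fun k => star (s k i) * s k j).symm⟩

/-- Stack the rows of the two factors. -/
lemma add [NonUnitalSemiring B] [Star B] {P Q : ι → ι → B} (hP : IsGramMatrix P)
    (hQ : IsGramMatrix Q) : IsGramMatrix fun i j => P i j + Q i j := by
  obtain ⟨m, s, hs⟩ := hP
  obtain ⟨n, t, ht⟩ := hQ
  exact of_fintype (κ := Fin m ⊕ Fin n) (Sum.elim s t) fun i j => by
    rw [Fintype.sum_sum_type, hs, ht]
    rfl

lemma zero [NonUnitalSemiring B] [Star B] : IsGramMatrix fun _ _ : ι => (0 : B) :=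
  ⟨0, fun _ _ => 0, by simp⟩

lemma sum [NonUnitalSemiring B] [Star B] {κ : Type*} (t : Finset κ) {P : κ → ι → ι → B}
    (hP : ∀ k ∈ t, IsGramMatrix (P k)) : IsGramMatrix fun i j => ∑ k ∈ t, P k i j := by
  classical
  induction t using Finset.induction_on with
  | empty => simpa using zero
  | insert a t ha ih =>
    simp only [Finset.sum_insert ha]
    exact (hP a (by simp)).add (ih fun k hk => hP k (by simp [hk]))

/-- Restriction of a Gram matrix to a subset of the index set, extended by zero. -/
lemma mask [NonUnitalSemiring B] [StarRing B] {P : ι → ι → B} (hP : IsGramMatrix P)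
    (p : ι → Prop) [DecidablePred p] : IsGramMatrix fun i j => if p i ∧ p j then P i j else 0 := by
  obtain ⟨n, s, hs⟩ := hP
  refine ⟨n, fun k i => if p i then s k i else 0, fun i j => ?_⟩
  by_cases hi : p i <;> by_cases hj : p j <;> simp [hi, hj, hs]

lemma star_mul_mul [NonUnitalSemiring B] [StarRing B] {P : ι → ι → B} (hP : IsGramMatrix P)
    (b : ι → B) : IsGramMatrix fun i j => star (b i) * P i j * b j := by
  obtain ⟨n, s, hs⟩ := hP
  refine ⟨n, fun k i => s k i * b i, fun i j => ?_⟩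
  simp only [hs, star_mul, Finset.mul_sum, Finset.sum_mul, mul_assoc]

variable [NonUnitalCStarAlgebra B] [PartialOrder B] [StarOrderedRing B]

/-- A hermitian matrix `P` with `a* P a ≥ 0` for all columns `a` is a Gram matrix. -/
lemma of_nonneg [Fintype ι] {P : ι → ι → B} (hstar : ∀ i j, star (P i j) = P j i)
    (h : ∀ a : ι → B, 0 ≤ ∑ i, ∑ j, star (a i) * P i j * a j) : IsGramMatrix P := by
  classical
  let M : CStarMatrix ι ι B := CStarMatrix.ofMatrix (Matrix.of P)
  have hM : IsSelfAdjoint M := by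
    ext i j
    exact hstar j i
  obtain ⟨N, T, hTT, hs⟩ := hM.exists_star_mul_self_eq_neg
  -- A diagonal entry of `T* T = -N* M N` is minus the form evaluated at a column of `N`, so it is
  -- `≤ 0`; it is also a sum of squares, so every entry of that column of `T` vanishes.
  have hT0 : T = 0 := by
    ext i k
    have h1 : (star T * T) k k ≤ 0 := by
      rw [hTT]
      refine neg_nonpos.2 ((h fun j => N j k).trans_eq ?_)
      rw [CStarMatrix.mul_apply, Finset.sum_comm]
      simp only [CStarMatrix.mul_apply, Finset.sum_mul]
      rfl
    have h2 : (star T * T) k k = ∑ l, star (T l k) * T l k := by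
      rw [CStarMatrix.mul_apply]
      rfl
    rw [h2] at h1
    have h3 := (Finset.sum_eq_zero_iff_of_nonneg fun l _ => star_mul_self_nonneg (T l k)).1
      (le_antisymm h1 (Finset.sum_nonneg fun l _ => star_mul_self_nonneg (T l k))) i
      (Finset.mem_univ i)
    exact (CStarRing.star_mul_self_eq_zero_iff _).1 h3
  obtain ⟨s, hs⟩ := hs hT0
  refine of_fintype (fun k i => s k i) fun i j => ?_
  change M i j = _
  rw [hs, CStarMatrix.mul_apply]
  rfl

-- The double sum is `f` applied to a sum over the rows `k` of squares of `∑ cᵢ sₖᵢ`. This turns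
-- `B`-valued positivity into positivity of a scalar kernel.
open scoped ComplexOrder in
lemma sum_nonneg {B : Type*} [NonUnitalCStarAlgebra B] [PartialOrder B] [StarOrderedRing B]
    {P : ι → ι → B} (hP : IsGramMatrix P) (f : B →ₚ[ℂ] ℂ) (t : Finset ι) (c : ι → ℂ) :
    0 ≤ ∑ i ∈ t, ∑ j ∈ t, star (c i) * c j * f (P i j) := by
  obtain ⟨n, s, hs⟩ := hP
  have h1 : ∀ k, star (∑ i ∈ t, c i • s k i) * ∑ j ∈ t, c j • s k j =
      ∑ i ∈ t, ∑ j ∈ t, (star (c i) * c j) • (star (s k i) * s k j) := fun k => by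
    simp only [star_sum, Finset.sum_mul_sum, star_smul, smul_mul_smul_comm]
  have h : ∑ i ∈ t, ∑ j ∈ t, star (c i) * c j * f (P i j) =
      f (∑ k, star (∑ i ∈ t, c i • s k i) * ∑ j ∈ t, c j • s k j) := by
    simp only [h1, hs, map_sum, map_smul, smul_eq_mul, Finset.mul_sum]
    rw [Finset.sum_comm (s := Finset.univ)]
    exact Finset.sum_congr rfl fun i _ => Finset.sum_comm
  rw [h]
  exact map_nonneg f (Finset.sum_nonneg fun k _ => star_mul_self_nonneg _)

end IsGramMatrix

/-! ### Hilbert spaces and operators from scalar kernels. -/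

open Finsupp (single lmapDomain)

/-- Every positive semidefinite scalar kernel is the Gram matrix of a family of vectors
with dense span in a Hilbert space. -/
lemma exists_hilbertSpace_of_kernel {α : Type u} (K : α → α → ℂ)
    (hstar : ∀ a b, star (K a b) = K b a)
    (hpos : ∀ (t : Finset α) (c : α → ℂ),
      0 ≤ (∑ a ∈ t, ∑ b ∈ t, star (c a) * c b * K a b).re) :
    ∃ (H : Type u) (_ : NormedAddCommGroup H) (_ : InnerProductSpace ℂ H) (_ : CompleteSpace H)
      (j : (α →₀ ℂ) →ₗ[ℂ] H), DenseRange j ∧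
        ∀ a b, inner ℂ (j (single a 1)) (j (single b 1)) = K a b := by
  let core : PreInnerProductSpace.Core ℂ (α →₀ ℂ) :=
    { inner := fun x y => x.sum fun a c => y.sum fun b d => star c * d * K a b
      conj_inner_symm := fun x y => by
        rw [Finsupp.sum_comm]
        simp only [map_finsuppSum]
        refine Finsupp.sum_congr fun a _ => Finsupp.sum_congr fun b _ => ?_
        rw [← hstar a b]
        simp [mul_comm]
      re_inner_nonneg := fun x => hpos x.support x
      add_left := fun x y z => by
        rw [Finsupp.sum_add_index'] <;> simp [← Finsupp.sum_add, add_mul]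
      smul_left := fun x y r => by
        rw [Finsupp.sum_smul_index] <;> simp [Finsupp.mul_sum, ← mul_assoc] }
  let _ : SeminormedAddCommGroup (α →₀ ℂ) :=
    InnerProductSpace.Core.toSeminormedAddCommGroup (𝕜 := ℂ)
  let _ : InnerProductSpace ℂ (α →₀ ℂ) := .ofCore core
  -- The kernel is only semidefinite; the Hausdorff completion also divides out the null vectors.
  refine ⟨UniformSpace.Completion (α →₀ ℂ), inferInstance, inferInstance, inferInstance,
    (UniformSpace.Completion.toComplL (𝕜 := ℂ) (E := α →₀ ℂ)).toLinearMap,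
    UniformSpace.Completion.denseRange_coe, fun a b => ?_⟩
  refine (UniformSpace.Completion.inner_coe _ _).trans ?_
  change (single a (1 : ℂ)).sum (fun a c => (single b (1 : ℂ)).sum
    fun b d => star c * d * K a b) = K a b
  simp

namespace KernelHilbert

variable {α : Type*} {H : Type*} [NormedAddCommGroup H] [InnerProductSpace ℂ H]
  {j : (α →₀ ℂ) →ₗ[ℂ] H}

lemma ext_inner (hj : DenseRange j) {x y : H}
    (h : ∀ a, inner ℂ (j (single a 1)) x = inner ℂ (j (single a 1)) y) : x = y := by
  refine hj.eq_of_inner_right ℂ fun v => ?_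
  induction v using Finsupp.induction_linear with
  | zero => simp
  | add f g hf hg => rw [map_add, inner_add_left, inner_add_left, hf, hg]
  | single a c => rw [← mul_one c, ← smul_eq_mul, ← Finsupp.smul_single, map_smul,
      inner_smul_left, inner_smul_left, h]

lemma clm_ext (hj : DenseRange j) {S T : H →L[ℂ] H}
    (h : ∀ a, S (j (single a 1)) = T (j (single a 1))) : S = T := by
  have hST : S.toLinearMap ∘ₗ j = T.toLinearMap ∘ₗ j := Finsupp.lhom_ext' fun a =>
    LinearMap.ext_ring (h a)
  refine ContinuousLinearMap.ext fun x => ?_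
  exact congrFun (hj.equalizer S.continuous T.continuous
    (funext fun v => LinearMap.congr_fun hST v)) x

/-- Both sides are sesquilinear in `(v, w)`, so an identity between kernels extends from basis
vectors to formal sums. It is needed to prove bounds before the operators on `H` exist. -/
lemma inner_eq_of_single {S T S' T' : (α →₀ ℂ) →ₗ[ℂ] H}
    (h : ∀ a b, inner ℂ (S (single a 1)) (T (single b 1)) =
      inner ℂ (S' (single a 1)) (T' (single b 1))) (v w : α →₀ ℂ) :
    inner ℂ (S v) (T w) = inner ℂ (S' v) (T' w) := by
  induction v using Finsupp.induction_linear with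
  | zero => simp
  | add f g hf hg => simp only [map_add, inner_add_left, hf, hg]
  | single a c =>
    rw [← mul_one c, ← smul_eq_mul, ← Finsupp.smul_single]
    simp only [map_smul, inner_smul_left]
    congr 1
    induction w using Finsupp.induction_linear with
    | zero => simp
    | add f g hf hg => simp only [map_add, inner_add_right, hf, hg]
    | single b d =>
      rw [← mul_one d, ← smul_eq_mul, ← Finsupp.smul_single]
      simp only [map_smul, inner_smul_right, h]

/-- A bounded map of the index set induces an operator. -/
lemma exists_clm [CompleteSpace H] (hj : DenseRange j) (σ : α → α) {C : ℝ}
    (hC : ∀ v, ‖j (lmapDomain ℂ ℂ σ v)‖ ≤ C * ‖j v‖) :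
    ∃ T : H →L[ℂ] H, ∀ a, T (j (single a 1)) = j (single (σ a) 1) := by
  refine ⟨(j ∘ₗ lmapDomain ℂ ℂ σ).extendOfNorm j, fun a => ?_⟩
  rw [LinearMap.extendOfNorm_eq hj ⟨C, hC⟩]
  simp

section Action

variable {B : Type*} [CStarAlgebra B] {K : α → α → ℂ} {σ : B → α → α}

/-- An action of a C*-algebra on the index set that is compatible with the kernel is bounded. -/
lemma norm_action_le (hj : DenseRange j)
    (hK : ∀ a b, inner ℂ (j (single a 1)) (j (single b 1)) = K a b)
    (hadj : ∀ b x y, K (σ b x) y = K x (σ (star b) y))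
    (hmul : ∀ b c x, σ (b * c) x = σ b (σ c x))
    (hadd : ∀ b c x y, K x (σ (b + c) y) = K x (σ b y) + K x (σ c y))
    (hsmul : ∀ (z : ℂ) b x y, K x (σ (z • b) y) = z * K x (σ b y)) (b : B) (v : α →₀ ℂ) :
    ‖j (lmapDomain ℂ ℂ (σ b) v)‖ ≤ ‖b‖ * ‖j v‖ := by
  let _ : PartialOrder B := CStarAlgebra.spectralOrder B
  let _ : StarOrderedRing B := CStarAlgebra.spectralOrderedRing B
  let P : B → (α →₀ ℂ) →ₗ[ℂ] H := fun b => j ∘ₗ lmapDomain ℂ ℂ (σ b)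
  have hP : ∀ b a, P b (single a 1) = j (single (σ b a) 1) := fun b a => by simp [P]
  have hPP : ∀ c v, inner ℂ (P c v) (P c v) = inner ℂ (j v) (P (star c * c) v) := fun c v =>
    inner_eq_of_single (S := P c) (T := P c) (S' := j) (T' := P (star c * c))
      (fun x y => by simp only [hP, hK, hmul, hadj]) v v
  have hPadd : ∀ c d v, P (c + d) v = P c v + P d v := fun c d v =>
    LinearMap.congr_fun (f := P (c + d)) (g := P c + P d) (Finsupp.lhom_ext' fun a =>
      LinearMap.ext_ring (ext_inner hj fun x => by
        change inner ℂ _ (P (c + d) (single a 1)) =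
          inner ℂ _ (P c (single a 1) + P d (single a 1))
        rw [inner_add_right, hP, hP, hP, hK, hK, hK, hadd])) v
  have hPsmul : ∀ (z : ℂ) c v, P (z • c) v = z • P c v := fun z c v =>
    LinearMap.congr_fun (f := P (z • c)) (g := z • P c) (Finsupp.lhom_ext' fun a =>
      LinearMap.ext_ring (ext_inner hj fun x => by
        change inner ℂ _ (P (z • c) (single a 1)) = inner ℂ _ (z • P c (single a 1))
        rw [inner_smul_right, hP, hP, hK, hK, hsmul])) v
  have hsq : ∀ c, ‖P c v‖ ^ 2 = (inner ℂ (j v) (P (star c * c) v)).re := fun c => by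
    rw [← hPP, ← inner_self_eq_norm_sq (𝕜 := ℂ)]
    rfl
  -- The unit need not act as the identity, but `1* 1 = 1` gives `‖P 1 v‖² = ⟨j v, P 1 v⟩`, and
  -- Cauchy–Schwarz applies.
  have h1 : ‖P 1 v‖ ≤ ‖j v‖ := by
    have h := hsq 1
    rw [star_one, one_mul] at h
    have h2 : ‖P 1 v‖ * ‖P 1 v‖ ≤ ‖j v‖ * ‖P 1 v‖ := by
      rw [← sq, h]
      exact (Complex.re_le_norm _).trans (norm_inner_le_norm _ _)
    rcases (norm_nonneg (P 1 v)).eq_or_lt with h0 | h0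
    · rw [← h0]; positivity
    · exact le_of_mul_le_mul_right h2 h0
  -- Choose `c` with `c* c = ‖b‖² - b* b`; then `‖P b v‖² + ‖P c v‖² = ‖b‖² ‖P 1 v‖²`, which bounds
  -- the first term.
  obtain ⟨c, hc⟩ := CStarAlgebra.nonneg_iff_eq_star_mul_self.1
    (sub_nonneg.2 (CStarAlgebra.star_mul_le_algebraMap_norm_sq (a := b)))
  have hsum : star b * b + star c * c = ((‖b‖ ^ 2 : ℝ) : ℂ) • (star (1 : B) * 1) := by
    rw [← hc, add_sub_cancel, Algebra.algebraMap_eq_smul_one, star_one, one_mul,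
      Complex.coe_smul]
  have key : ‖P b v‖ ^ 2 + ‖P c v‖ ^ 2 = ‖b‖ ^ 2 * ‖P 1 v‖ ^ 2 := by
    rw [hsq, hsq, hsq, ← Complex.add_re, ← inner_add_right, ← hPadd, hsum, hPsmul,
      inner_smul_right, Complex.re_ofReal_mul]
  refine le_of_sq_le_sq (a := ‖P b v‖) ?_ (by positivity)
  calc ‖P b v‖ ^ 2 ≤ ‖b‖ ^ 2 * ‖P 1 v‖ ^ 2 := by rw [← key]; linarith [sq_nonneg ‖P c v‖]
    _ ≤ ‖b‖ ^ 2 * ‖j v‖ ^ 2 := by gcongr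
    _ = (‖b‖ * ‖j v‖) ^ 2 := by ring

/-- An action of a C*-algebra on the index set that is compatible with the kernel induces a
representation. -/
lemma exists_rep [CompleteSpace H] (hj : DenseRange j)
    (hK : ∀ a b, inner ℂ (j (single a 1)) (j (single b 1)) = K a b)
    (hadj : ∀ b x y, K (σ b x) y = K x (σ (star b) y))
    (hmul : ∀ b c x, σ (b * c) x = σ b (σ c x))
    (hadd : ∀ b c x y, K x (σ (b + c) y) = K x (σ b y) + K x (σ c y))
    (hsmul : ∀ (z : ℂ) b x y, K x (σ (z • b) y) = z * K x (σ b y)) :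
    ∃ π : B →⋆ₙₐ[ℂ] (H →L[ℂ] H), ∀ b a, π b (j (single a 1)) = j (single (σ b a) 1) := by
  choose T hT using fun b : B =>
    exists_clm hj (σ b) (norm_action_le hj hK hadj hmul hadd hsmul b)
  -- The action on indices is not linear in `b`. Linearity appears only in `H`, where vectors with
  -- equal inner products against the generators coincide.
  have hTsmul : ∀ (z : ℂ) b, T (z • b) = z • T b := fun z b => clm_ext hj fun x => by
    refine ext_inner hj fun y => ?_
    rw [_root_.smul_apply, inner_smul_right, hT, hT, hK, hK, hsmul]
  exact ⟨{
    toFun := T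
    map_smul' := hTsmul
    map_zero' := by simpa using hTsmul 0 0
    map_add' := fun b c => clm_ext hj fun x => by
      refine ext_inner hj fun y => ?_
      rw [_root_.add_apply, inner_add_right, hT, hT, hT, hK, hK, hK, hadd]
    map_mul' := fun b c => clm_ext hj fun x => by
      rw [mul_apply_eq_comp, hT, hT, hT, hmul]
    map_star' := fun b => clm_ext hj fun x => by
      refine ext_inner hj fun y => ?_
      rw [ContinuousLinearMap.star_eq_adjoint, ContinuousLinearMap.adjoint_inner_right, hT, hT,
        hK, hK, hadj] }, hT⟩

end Action

end KernelHilbert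

/-! ### Gram matrices of vectors in a Hilbert module. -/

namespace CStarCorr

section RankOneGram

variable {B : Type u} {X : Type v} [NonUnitalCStarAlgebra B] [PartialOrder B]
  [NormedAddCommGroup X] [NormedSpace ℂ X] [SMul Bᵐᵒᵖ X]
  [CStarModule Bᵐᵒᵖ X]

lemma rinner_zero_right (ξ : X) : rinner B ξ 0 = 0 := by simp [rinner]

lemma rinner_sum_right {κ : Type*} (t : Finset κ) (ξ : X) (η : κ → X) :
    rinner B ξ (∑ k ∈ t, η k) = ∑ k ∈ t, rinner B ξ (η k) := by
  classical
  induction t using Finset.induction_on with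
  | empty => simp [rinner_zero_right]
  | insert a t ha ih => rw [Finset.sum_insert ha, Finset.sum_insert ha, rinner_add_right, ih]

lemma rinner_self_nonneg (ξ : X) : 0 ≤ rinner B ξ ξ :=
  MulOpposite.unop_nonneg.2 CStarModule.inner_self_nonneg

/-- The matrix of inner products of finitely many vectors is a Gram matrix over `B`. -/
lemma isGramMatrix_rinner [StarOrderedRing B] {ι : Type*} [Fintype ι] (ξ : ι → X) :
    IsGramMatrix fun i j => rinner B (ξ i) (ξ j) := by
  refine .of_nonneg (fun i j => star_rinner _ _) fun a => ?_
  -- The form at the column `a` is the inner square of `∑ ξᵢ · aᵢ`.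
  refine (rinner_self_nonneg (∑ i, ract (ξ i) (a i))).trans_eq ?_
  rw [← star_rinner, rinner_sum_right, star_sum]
  refine Finset.sum_congr rfl fun i _ => ?_
  rw [star_rinner, rinner_sum_right]
  exact Finset.sum_congr rfl fun j _ => by rw [rinner_ract, rinner_ract_left]

end RankOneGram

variable {B : Type u} {X : Type v} [CStarAlgebra B] [PartialOrder B]
  [StarOrderedRing B] [NormedAddCommGroup X] [NormedSpace ℂ X] [CompleteSpace X]
  [SMul Bᵐᵒᵖ X] [CStarModule Bᵐᵒᵖ X]

/-! ### The Fock kernel on words. -/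

namespace Correspondence

open scoped ComplexOrder

variable (E : Correspondence B X)

/-- The map `a ↦ ⟨ξ|φ(a)η⟩`. -/
def coef (ξ η : X) : B →ₗ[ℂ] B where
  toFun a := rinner B ξ (E.leftAct a η)
  map_add' a b := by rw [map_add, _root_.add_apply, rinner_add_right]
  map_smul' z a := by
    rw [map_smul, _root_.smul_apply, rinner_smul_right, RingHom.id_apply]

lemma coef_apply (ξ η : X) (a : B) : E.coef ξ η a = rinner B ξ (E.leftAct a η) := rfl

lemma star_coef (ξ η : X) (a : B) : star (E.coef ξ η a) = E.coef η ξ (star a) := by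
  rw [coef_apply, coef_apply, star_rinner, E.rinner_leftAct]

/-- The map `a ↦ ⟨ξ₁ ⊗ ⋯ ⊗ ξₙ | φ(a) η₁ ⊗ ⋯ ⊗ ηₙ⟩`, zero on words of different lengths. -/
def wordCoef : List X → List X → B →ₗ[ℂ] B
  | [], [] => LinearMap.id
  | [], _ :: _ => 0
  | _ :: _, [] => 0
  | ξ :: l, η :: m => wordCoef l m ∘ₗ E.coef ξ η

/-- The inner product `⟨ξ₁ ⊗ ⋯ ⊗ ξₙ | η₁ ⊗ ⋯ ⊗ ηₙ⟩`, zero on words of different lengths. -/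
def wordInner : List X → List X → B
  | [], [] => 1
  | [], _ :: _ => 0
  | _ :: _, [] => 0
  | ξ :: l, η :: m => E.wordCoef l m (rinner B ξ η)

lemma star_wordCoef (l m : List X) (a : B) :
    star (E.wordCoef l m a) = E.wordCoef m l (star a) := by
  induction l generalizing m a with
  | nil => cases m <;> simp [wordCoef]
  | cons ξ l ih => cases m <;> simp [wordCoef, ih, star_coef]

lemma star_wordInner (l m : List X) : star (E.wordInner l m) = E.wordInner m l := by
  cases l <;> cases m <;> simp [wordInner, star_wordCoef, star_rinner]

/-- Complete positivity: if `A = s* s`, the new entries are `∑ₖ ⟨φ(sₖᵢ)ξᵢ | φ(sₖⱼ)ξⱼ⟩`, a sum of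
matrices of inner products. -/
lemma isGramMatrix_coef {ι : Type*} [Fintype ι] {A : ι → ι → B} (hA : IsGramMatrix A)
    (ξ : ι → X) : IsGramMatrix fun i j => E.coef (ξ i) (ξ j) (A i j) := by
  obtain ⟨n, s, hs⟩ := hA
  have h := IsGramMatrix.sum Finset.univ fun k (_ : k ∈ Finset.univ) =>
    isGramMatrix_rinner (B := B) fun i => E.leftAct (s k i) (ξ i)
  suffices heq : (fun i j => E.coef (ξ i) (ξ j) (A i j)) = fun i j =>
      ∑ k, rinner B (E.leftAct (s k i) (ξ i)) (E.leftAct (s k j) (ξ j)) by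
    rw [heq]
    exact h
  funext i j
  rw [hs, map_sum]
  refine Finset.sum_congr rfl fun k _ => ?_
  rw [E.rinner_leftAct, coef_apply, map_mul]
  rfl

-- Separates empty from nonempty words so that each summand is a masked Gram matrix. The default
-- head `0` occurs only where the mask already gives `0`.
open Classical in
lemma wordCoef_eq_add (l m : List X) (a : B) : E.wordCoef l m a =
    (if l = [] ∧ m = [] then a else 0) + E.wordCoef l.tail m.tail
      (if l ≠ [] ∧ m ≠ [] then E.coef (l.headD 0) (m.headD 0) a else 0) := by
  cases l <;> cases m <;> simp [wordCoef]

open Classical in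
lemma wordInner_eq_add (l m : List X) : E.wordInner l m =
    (if l = [] ∧ m = [] then 1 else 0) + E.wordCoef l.tail m.tail
      (if l ≠ [] ∧ m ≠ [] then rinner B (l.headD 0) (m.headD 0) else 0) := by
  cases l <;> cases m <;> simp [wordInner]

/-- Induction on a bound for the lengths: empty words keep their block of `A`, while nonempty words
pass through `coef` and lose a letter. `A` must vary, since each letter changes it. -/
lemma isGramMatrix_wordCoef {ι : Type*} [Fintype ι] (n : ℕ) (l : ι → List X)
    (hl : ∀ i, (l i).length ≤ n) {A : ι → ι → B} (hA : IsGramMatrix A) :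
    IsGramMatrix fun i j => E.wordCoef (l i) (l j) (A i j) := by
  classical
  induction n generalizing l A with
  | zero =>
    have h : ∀ i, l i = [] := fun i => List.length_eq_zero_iff.1 (Nat.le_zero.1 (hl i))
    simpa [h, wordCoef] using hA
  | succ n ih =>
    simp only [E.wordCoef_eq_add (l _)]
    refine (hA.mask fun i => l i = []).add (ih (fun i => (l i).tail) (fun i => ?_)
      ((E.isGramMatrix_coef hA fun i => (l i).headD 0).mask fun i => l i ≠ []))
    have := hl i
    simp only [List.length_tail]
    omega

lemma isGramMatrix_wordInner {ι : Type*} [Fintype ι] (l : ι → List X) :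
    IsGramMatrix fun i j => E.wordInner (l i) (l j) := by
  classical
  simp only [E.wordInner_eq_add (l _)]
  -- The all-ones matrix has a single row of ones as its factor; its mask is the block of empty
  -- words.
  have h1 : IsGramMatrix fun _ _ : ι => (1 : B) := ⟨1, fun _ _ => 1, by simp⟩
  exact (h1.mask fun i => l i = []).add
    (E.isGramMatrix_wordCoef (Finset.univ.sup fun i => (l i).tail.length) _
      (fun i => Finset.le_sup (f := fun i => (l i).tail.length) (Finset.mem_univ i))
      ((isGramMatrix_rinner fun i => (l i).headD 0).mask fun i => l i ≠ []))

/-- The kernel of the Fock space of `E`, induced by a positive functional on `B`. -/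
def fockKernel (f : B →ₚ[ℂ] ℂ) (x y : List X × B) : ℂ :=
  f (star x.2 * E.wordInner x.1 y.1 * y.2)

lemma star_fockKernel (f : B →ₚ[ℂ] ℂ) (x y : List X × B) :
    star (E.fockKernel f x y) = E.fockKernel f y x := by
  rw [fockKernel, fockKernel, ← map_star]
  simp [star_wordInner, mul_assoc]

lemma fockKernel_nonneg (f : B →ₚ[ℂ] ℂ) (t : Finset (List X × B)) (c : List X × B → ℂ) :
    0 ≤ ∑ x ∈ t, ∑ y ∈ t, star (c x) * c y * E.fockKernel f x y := by
  have h := (((E.isGramMatrix_wordInner fun i : t => i.1.1).star_mul_mul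
    fun i : t => i.1.2).sum_nonneg f Finset.univ fun i => c i)
  refine h.trans_eq ?_
  rw [← Finset.sum_coe_sort t]
  refine Finset.sum_congr rfl fun i _ => ?_
  rw [← Finset.sum_coe_sort t]
  rfl

/-- The left action of `B` on words. -/
def wordAct (b : B) : List X × B → List X × B
  | ([], c) => ([], b * c)
  | (ξ :: l, c) => (E.leftAct b ξ :: l, c)

/-- In degree zero this is the adjoint of left multiplication; in positive degree it is the adjoint
relation for `φ`, applied to the first letters. -/
lemma fockKernel_wordAct (f : B →ₚ[ℂ] ℂ) (b : B) (x y : List X × B) :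
    E.fockKernel f (E.wordAct b x) y = E.fockKernel f x (E.wordAct (star b) y) := by
  rcases x with ⟨_ | ⟨ξ, l⟩, c⟩ <;> rcases y with ⟨_ | ⟨η, m⟩, d⟩ <;>
    simp [fockKernel, wordAct, wordInner, mul_assoc, E.rinner_leftAct]

lemma wordAct_mul (b c : B) (x : List X × B) :
    E.wordAct (b * c) x = E.wordAct b (E.wordAct c x) := by
  rcases x with ⟨_ | ⟨ξ, l⟩, d⟩ <;> simp [wordAct, mul_assoc]

lemma fockKernel_wordAct_add (f : B →ₚ[ℂ] ℂ) (b c : B) (x y : List X × B) :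
    E.fockKernel f x (E.wordAct (b + c) y) =
      E.fockKernel f x (E.wordAct b y) + E.fockKernel f x (E.wordAct c y) := by
  rcases x with ⟨_ | ⟨ξ, l⟩, a⟩ <;> rcases y with ⟨_ | ⟨η, m⟩, d⟩ <;>
    simp [fockKernel, wordAct, wordInner, mul_add, add_mul, rinner_add_right]

lemma fockKernel_wordAct_smul (f : B →ₚ[ℂ] ℂ) (z : ℂ) (b : B) (x y : List X × B) :
    E.fockKernel f x (E.wordAct (z • b) y) = z * E.fockKernel f x (E.wordAct b y) := by
  rcases x with ⟨_ | ⟨ξ, l⟩, a⟩ <;> rcases y with ⟨_ | ⟨η, m⟩, d⟩ <;>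
    simp [fockKernel, wordAct, wordInner, rinner_smul_right]

/-- Creation on words. -/
def wordCons (ξ : X) (x : List X × B) : List X × B := (ξ :: x.1, x.2)

/-- The relation `t(ξ)* t(η) = π(⟨ξ|η⟩)` at the level of the kernel; it yields both the bound on
creation operators and the Toeplitz relation itself. -/
lemma fockKernel_wordCons (f : B →ₚ[ℂ] ℂ) (ξ η : X) (x y : List X × B) :
    E.fockKernel f (wordCons ξ x) (wordCons η y) =
      E.fockKernel f x (E.wordAct (rinner B ξ η) y) := by
  rcases x with ⟨_ | ⟨ξ, l⟩, a⟩ <;> rcases y with ⟨_ | ⟨η, m⟩, d⟩ <;>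
    simp [fockKernel, wordAct, wordCons, wordInner, wordCoef, coef_apply, mul_assoc]

lemma fockKernel_wordCons_add (f : B →ₚ[ℂ] ℂ) (ξ η : X) (x y : List X × B) :
    E.fockKernel f x (wordCons (ξ + η) y) =
      E.fockKernel f x (wordCons ξ y) + E.fockKernel f x (wordCons η y) := by
  rcases x with ⟨_ | ⟨ξ, l⟩, a⟩ <;>
    simp [fockKernel, wordCons, wordInner, mul_add, add_mul, rinner_add_right]

lemma fockKernel_wordCons_smul (f : B →ₚ[ℂ] ℂ) (z : ℂ) (ξ : X) (x y : List X × B) :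
    E.fockKernel f x (wordCons (z • ξ) y) = z * E.fockKernel f x (wordCons ξ y) := by
  rcases x with ⟨_ | ⟨ξ, l⟩, a⟩ <;>
    simp [fockKernel, wordCons, wordInner, rinner_smul_right]

lemma wordAct_wordCons (b : B) (ξ : X) (x : List X × B) :
    E.wordAct b (wordCons ξ x) = wordCons (E.leftAct b ξ) x := rfl

/-! ### The Fock representation. -/

/-- The Fock representation of `E` on the Hilbert space induced by a positive functional on `B`. -/
theorem exists_fockRep (f : B →ₚ[ℂ] ℂ) : ∃ (H : Type (max u v)) (_ : NormedAddCommGroup H)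
    (_ : InnerProductSpace ℂ H) (_ : CompleteSpace H) (e : List X × B → H)
    (R : ToeplitzRep E (H →L[ℂ] H)), (∀ x y, inner ℂ (e x) (e y) = E.fockKernel f x y) ∧
      (∀ S T : H →L[ℂ] H, (∀ x, S (e x) = T (e x)) → S = T) ∧
      (∀ b x, R.π b (e x) = e (E.wordAct b x)) ∧ (∀ ξ x, R.t ξ (e x) = e (wordCons ξ x)) ∧
      ∀ ξ c, star (R.t ξ) (e ([], c)) = 0 := by
  obtain ⟨H, _, _, _, j, hj, hK⟩ := exists_hilbertSpace_of_kernel (E.fockKernel f)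
    (E.star_fockKernel f) fun t c => (Complex.nonneg_iff.1 (E.fockKernel_nonneg f t c)).1
  have hact := KernelHilbert.norm_action_le hj hK (E.fockKernel_wordAct f) E.wordAct_mul
    (E.fockKernel_wordAct_add f) (E.fockKernel_wordAct_smul f)
  obtain ⟨π, hπ⟩ := KernelHilbert.exists_rep hj hK (E.fockKernel_wordAct f) E.wordAct_mul
    (E.fockKernel_wordAct_add f) (E.fockKernel_wordAct_smul f)
  -- The squared norm of `ξ ⊗ v` is `⟨v, π(⟨ξ|ξ⟩) v⟩`, so the bound for the action of `B` gives
  -- `‖ξ‖² ‖v‖²`.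
  have hcons : ∀ (ξ : X) v, ‖j (lmapDomain ℂ ℂ (wordCons ξ) v)‖ ≤ ‖ξ‖ * ‖j v‖ := by
    intro ξ v
    have h1 := KernelHilbert.inner_eq_of_single (S := j ∘ₗ lmapDomain ℂ ℂ (wordCons ξ))
      (T := j ∘ₗ lmapDomain ℂ ℂ (wordCons ξ)) (S' := j)
      (T' := j ∘ₗ lmapDomain ℂ ℂ (E.wordAct (rinner B ξ ξ)))
      (fun x y => by
        simp only [LinearMap.comp_apply, Finsupp.lmapDomain_apply, Finsupp.mapDomain_single]
        rw [hK, hK, fockKernel_wordCons]) v v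
    refine le_of_sq_le_sq ?_ (by positivity)
    calc ‖j (lmapDomain ℂ ℂ (wordCons ξ) v)‖ ^ 2
        = ‖inner ℂ (j v) (j (lmapDomain ℂ ℂ (E.wordAct (rinner B ξ ξ)) v))‖ := by
          rw [LinearMap.comp_apply, LinearMap.comp_apply] at h1
          rw [← h1, inner_self_eq_norm_sq_to_K]
          simp
      _ ≤ ‖j v‖ * (‖rinner B ξ ξ‖ * ‖j v‖) :=
          (norm_inner_le_norm _ _).trans (mul_le_mul_of_nonneg_left (hact _ _) (norm_nonneg _))
      _ = (‖ξ‖ * ‖j v‖) ^ 2 := by rw [← norm_sq_rinner]; ring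
  choose T hT using fun ξ => KernelHilbert.exists_clm hj (wordCons ξ) (hcons ξ)
  have hTinner : ∀ ξ x y, inner ℂ (j (single x 1)) (T ξ (j (single y 1))) =
      E.fockKernel f x (wordCons ξ y) := fun ξ x y => by rw [hT, hK]
  refine ⟨H, _, _, _, fun x => j (single x 1),
    { π := π
      t := {
        toFun := T
        map_add' := fun ξ η => KernelHilbert.clm_ext hj fun y =>
          KernelHilbert.ext_inner hj fun x => by
            rw [_root_.add_apply, inner_add_right, hTinner, hTinner, hTinner,
              fockKernel_wordCons_add]
        map_smul' := fun z ξ => KernelHilbert.clm_ext hj fun y =>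
          KernelHilbert.ext_inner hj fun x => by
            rw [RingHom.id_apply, _root_.smul_apply, inner_smul_right, hTinner, hTinner,
              fockKernel_wordCons_smul] }
      π_mul_t := fun b ξ => KernelHilbert.clm_ext hj fun x => by
        change π b (T ξ _) = T (E.leftAct b ξ) _
        rw [hT, hT, hπ, wordAct_wordCons]
      star_t_mul_t := fun ξ η => KernelHilbert.clm_ext hj fun y =>
        KernelHilbert.ext_inner hj fun x => by
          change inner ℂ _ (star (T ξ) (T η _)) = inner ℂ _ (π _ _)
          rw [ContinuousLinearMap.star_eq_adjoint, ContinuousLinearMap.adjoint_inner_right, hT, hT,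
            hπ, hK, hK, fockKernel_wordCons] },
    hK, fun S T h => KernelHilbert.clm_ext hj h, hπ, hT, fun ξ c => ?_⟩
  -- Annihilation kills degree zero because the kernel vanishes between an empty and a nonempty
  -- word.
  refine KernelHilbert.ext_inner hj fun x => ?_
  change inner ℂ _ (star (T ξ) _) = _
  rw [ContinuousLinearMap.star_eq_adjoint, ContinuousLinearMap.adjoint_inner_right, hT, hK,
    inner_zero_right]
  simp [fockKernel, wordCons, wordInner]

end Correspondence
end CStarCorr

/-! ### How `ψ_t` acts on creation operators and on the vacuum. -/

namespace CStarCorr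

namespace ToeplitzRep

section

variable {B : Type u} {X : Type v} [NonUnitalCStarAlgebra B] [PartialOrder B]
  [StarOrderedRing B] [NormedAddCommGroup X] [NormedSpace ℂ X] [CompleteSpace X]
  [SMul Bᵐᵒᵖ X] [CStarModule Bᵐᵒᵖ X] {E : Correspondence B X}

/-- Known for finite sums of rank-one operators, and both sides are continuous in `T`. With `T =
φ(b)` it shows that `ψ_t(φ(b))` and `π(b)` agree after right multiplication by any `t(μ)`. -/
lemma compactMap_mul_t {D : Type w} [NonUnitalCStarAlgebra D] (R : ToeplitzRep E D)
    (T : compactOps B X) (μ : X) : R.compactMap T * R.t μ = R.t ((T : X →L[ℂ] X) μ) := by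
  have ht : Continuous R.t :=
    AddMonoidHomClass.continuous_of_bound R.t 1 fun x => by simpa using R.norm_t_le x
  have h1 : Continuous fun T : compactOps B X => R.compactMap T * R.t μ :=
    R.compactMap.continuous.mul continuous_const
  have h2 : Continuous fun T : compactOps B X => R.t ((T : X →L[ℂ] X) μ) :=
    ht.comp ((ContinuousLinearMap.apply ℂ X μ).continuous.comp continuous_subtype_val)
  refine congrFun (denseRange_finiteRank.equalizer h1 h2 (funext fun f => ?_)) T
  change R.compactMap (finiteRank B X f) * R.t μ = _
  rw [compactMap_finiteRank, finiteRankMap_mul_t]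
  rfl

lemma map_compactMap {D : Type*} [NonUnitalCStarAlgebra D] {D' : Type*}
    [NonUnitalCStarAlgebra D'] (R : ToeplitzRep E D) (R' : ToeplitzRep E D') (ρ : D →⋆ₙₐ[ℂ] D')
    (h : ∀ ξ, ρ (R.t ξ) = R'.t ξ) (T : compactOps B X) :
    ρ (R.compactMap T) = R'.compactMap T := by
  rw [← compactMap_map, R'.compactMap_unique (R.map ρ).compactMap fun ξ η => ?_]
  rw [compactMap_rankOne, ← h ξ, ← h η]
  rfl

/-- On finite sums the operator first applied to `x` is some `t(η)*`; density does the rest. -/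
lemma compactMap_apply_eq_zero {H : Type*} [NormedAddCommGroup H] [InnerProductSpace ℂ H]
    [CompleteSpace H] (R : ToeplitzRep E (H →L[ℂ] H)) {x : H} (hx : ∀ ξ, star (R.t ξ) x = 0)
    (T : compactOps B X) : R.compactMap T x = 0 := by
  have h1 : Continuous fun T : compactOps B X => R.compactMap T x :=
    (ContinuousLinearMap.apply ℂ H x).continuous.comp R.compactMap.continuous
  refine congrFun (denseRange_finiteRank.equalizer h1 continuous_const (funext fun f => ?_)) T
  change R.compactMap (finiteRank B X f) x = 0
  rw [compactMap_finiteRank, finiteRankMap]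
  induction f using Finsupp.induction_linear with
  | zero => simp
  | add f g hf hg => rw [map_add, _root_.add_apply, hf, hg, add_zero]
  | single p c =>
    rw [Finsupp.linearCombination_single, _root_.smul_apply, mul_apply_eq_comp, hx, map_zero,
      smul_zero]

end

end ToeplitzRep

variable {B : Type u} {X : Type v} [CStarAlgebra B] [PartialOrder B]
  [StarOrderedRing B] [NormedAddCommGroup X] [NormedSpace ℂ X] [CompleteSpace X]
  [SMul Bᵐᵒᵖ X] [CStarModule Bᵐᵒᵖ X]

/-! ### The separating representation and the conclusion. -/

open scoped ComplexOrder in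
/-- If a positive functional vanishes on an ideal `I` but not at `1`, then its Fock representation
is co-isometric on `I`, but not at `1`. -/
lemma Correspondence.exists_isCoisometricOn_ne (E : Correspondence B X)
    (hcompact : ∀ b : B, E.leftAct b ∈ compactOps B X) (I : TwoSidedIdeal B) (f : B →ₚ[ℂ] ℂ)
    (hf : ∀ b ∈ I, f b = 0) (hf1 : f 1 ≠ 0) :
    ∃ (H : Type (max u v)) (_ : NormedAddCommGroup H) (_ : InnerProductSpace ℂ H)
      (_ : CompleteSpace H) (R : ToeplitzRep E (H →L[ℂ] H)), R.IsCoisometricOn (I : Set B) ∧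
        R.π 1 ≠ R.compactMap ⟨E.leftAct 1, hcompact 1⟩ := by
  obtain ⟨H, _, _, _, e, R, hinner, hext, hπ, ht, hstar⟩ := E.exists_fockRep f
  refine ⟨H, _, _, _, R, fun b hb => ⟨hcompact b, hext _ _ ?_⟩, fun h => hf1 ?_⟩
  · rintro ⟨_ | ⟨ξ, l⟩, c⟩
    -- In degree zero `ψ_t` gives `0`, and `π(b)` sends the vector to one of squared norm `f((bc)*
    -- bc)`, which vanishes since `b ∈ I`.
    · rw [R.compactMap_apply_eq_zero (fun ξ => hstar ξ c), hπ, ← inner_self_eq_zero (𝕜 := ℂ),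
        hinner]
      exact hf _ (I.mul_mem_left _ _ (I.mul_mem_right _ _ hb))
    · have h1 : e (ξ :: l, c) = R.t ξ (e (l, c)) := (ht ξ (l, c)).symm
      rw [h1, ← mul_apply_eq_comp, ← mul_apply_eq_comp, R.compactMap_mul_t, R.π_mul_t]
  -- The vacuum is fixed by `π(1)` and killed by `ψ_t(φ(1))`; equality of these would make its
  -- squared norm `f 1` zero.
  · have h0 : e (([], 1) : List X × B) = 0 := by
      have h1 := hπ 1 ([], 1)
      rw [h, R.compactMap_apply_eq_zero (fun ξ => hstar ξ 1), Correspondence.wordAct,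
        mul_one] at h1
      exact h1.symm
    have h2 := hinner ([], 1) ([], 1)
    rw [h0, inner_zero_left] at h2
    simpa [Correspondence.fockKernel, Correspondence.wordInner] using h2.symm

end CStarCorr

end

theorem mainTheorem5 {B : Type*} {X : Type*} [CStarAlgebra B] [PartialOrder B]
    [StarOrderedRing B] [FiniteDimensional ℂ B] [NormedAddCommGroup X] [NormedSpace ℂ X]
    [CompleteSpace X] [SMul Bᵐᵒᵖ X] [CStarModule Bᵐᵒᵖ X]
    (E : CStarCorr.Correspondence B X)
    (hfaithful : Function.Injective E.leftAct)
    (hcompact : ∀ b : B, E.leftAct b ∈ CStarCorr.compactOps B X)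
    (I : TwoSidedIdeal B) (hclosed : IsClosed (I : Set B)) (hstar : ∀ a ∈ I, star a ∈ I)
    (hproper : I ≠ ⊤) (hI : (I : Set B) ⊆ E.katsuraIdeal) :
    Function.Surjective (CStarCorr.RelCuntzPimsner.toCuntzPimsner hI) ∧
      ¬ Function.Injective (CStarCorr.RelCuntzPimsner.toCuntzPimsner hI) := by
  refine ⟨CStarCorr.RelCuntzPimsner.toCuntzPimsner_surjective hI, fun hinj => ?_⟩
  obtain ⟨f, hf, hf1⟩ := I.exists_positive_functional hproper
  obtain ⟨H, _, _, _, R, hR, hne⟩ := E.exists_isCoisometricOn_ne hcompact I f hf hf1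
  have h1 : (1 : B) ∈ E.katsuraIdeal :=
    ⟨hcompact 1, fun x hx => by rw [mul_one, hfaithful (hx.trans (map_zero E.leftAct).symm)]⟩
  obtain ⟨_, hX⟩ := CStarCorr.RelCuntzPimsner.isCoisometricOn_univRep
    (S := E.katsuraIdeal) (fun _ h => h.1) 1 h1
  refine hne ?_
  rw [← CStarCorr.RelCuntzPimsner.lift_π R hR, ← CStarCorr.ToeplitzRep.map_compactMap _ _ _
    (CStarCorr.RelCuntzPimsner.lift_t R hR)]
  refine congrArg _ (hinj ?_)
  -- The canonical map sends `π(1)` and `ψ_t(φ(1))` of `𝒪(I, X)` to their counterparts in `𝒪_X`,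
  -- which coincide because `1` lies in the Katsura ideal.
  exact (CStarCorr.RelCuntzPimsner.lift_π _ _ 1).trans (hX.trans
    (CStarCorr.ToeplitzRep.map_compactMap _ _ (CStarCorr.RelCuntzPimsner.toCuntzPimsner hI)
      (CStarCorr.RelCuntzPimsner.lift_t _ _) _).symm)
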